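/- Let $G$ and $H$ be finite unrooted trees with weights $\omega(u,v)\in\mathbb R\cup\{-\infty\}$ for $(u,v)\in V_G\times V_H$ and $\omega(e,f)\in\mathbb R\cup\{-\infty\}$ for $(e,f)\in E_G\times E_H$. A common subtree isomorphism is an isomorphism $\varphi$ between an induced subgraph of $G$ that is a (nonempty) tree and an induced subgraph of $H$; its weight is the sum of $\omega(v,\varphi(v))$ and $\omega(vu,\varphi(v)\varphi(u))$ over all mapped vertices $v$ and mapped edges $vu$. The maximum common subtree isomorphism problem is to determine the maximum weight of a common subtree isomorphism. Algorithm. Select an arbitrary root $r\in V_G$ and let $G^r$ be the tree rooted at $r$. For each $u\in V_G$ in postorder on $G^r$, each $v\in V_H$ and each $s\in N(v)\cup\{v\}$, let $U$ be the set of children of $u$ in $G^r$ and $V$ the set of children of $v$ in $H^s$. If $\omega(u,v)=-\infty$, put $D(u,s,v)=-\infty$. Otherwise give each edge $u'v'$ of the complete bipartite graph on $U\uplus V$ the weight $\omega(uu',vv')+D(u',v,v')$, compute a maximum weight (not necessarily perfect) matching $M$ of it by a subroutine, and put $D(u,s,v)=\omega(u,v)+W(M)$, where $W(M)$ is the weight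 of $M$. Return the maximum entry of $D$. Running times are numbers of steps of a unit-cost random access machine with real arithmetic; trees are given by adjacency lists. The matching subroutine is a black box that, for parts of sizes $k$ and $l$, returns a maximum weight matching in time $\mathcal O(kl(\min\{k,l\}+\log\max\{k,l\})+1)$. Proposition. With any such matching subroutine, the algorithm solves the maximum common subtree isomorphism problem for all trees $G$ and $H$, all weights, all orders of the adjacency lists and all choices of $r$, in time $\mathcal O(n^4)$, where $n=|G|+|H|$ and the implied constant depends only on the constant in the time bound of the subroutine. Moreover, the Hungarian method (with the two sides exchanged if $k>l$) is such a subroutine; hence the algorithm with this subroutine solves the problem in time $\mathcal O(n^4)$. -/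

import Mathlib

noncomputable section

namespace TreeMCS

/-! ### Step counting

A unit-cost random access machine with real arithmetic: one step is charged for each table
access, arithmetic operation, comparison and loop iteration (several of them that belong together
are charged by a fixed number of steps). Tables are represented by functions. -/

/-- The result of a computation together with the number of steps it has taken. -/
structure Timed (α : Type) where
  val : α
  time : ℕ

instance : Monad Timed where
  pure a := ⟨a, 0⟩
  bind x f := ⟨(f x.val).val, x.time + (f x.val).time⟩

/-- Charge `n` steps. -/
def tick (n : ℕ) : Timed Unit := ⟨(), n⟩

/-- The loop `for x in xs do st ← body st x`; every iteration is charged one extra step. -/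
def forEach {ι σ : Type} : List ι → σ → (σ → ι → Timed σ) → Timed σ
  | [], st, _ => pure st
  | x :: xs, st, body => do
    tick 1
    let st' ← body st x
    forEach xs st' body

/-- The loop `for i in 0, …, n - 1 do A[i] ← f i` that fills a new array `A` of length `n`;
every iteration is charged one step in addition to the steps of `f i`. -/
def tabulate {α : Type} {n : ℕ} (f : Fin n → Timed α) : Timed (Fin n → α) :=
  ⟨fun i => (f i).val, ∑ i, ((f i).time + 1)⟩

/-! ### Common subtree isomorphisms and their weights -/

/-- A common subtree isomorphism of `G` and `H`: an isomorphism between induced subgraphs of `G`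
and `H` that are trees (in particular connected and nonempty). -/
structure CommonSubtreeIso {V W : Type} (G : SimpleGraph V) (H : SimpleGraph W) where
  dom : Set V
  cod : Set W
  iso : G.induce dom ≃g H.induce cod
  isTree : (G.induce dom).IsTree

open Classical in
/-- The weight of a common subtree isomorphism `φ`: the sum of the weights of all mapped vertices
and of all mapped edges. The weight of the pair of edges `e`, `f` is `wE e f`. -/
def CommonSubtreeIso.weight {V W : Type} [Fintype V] {G : SimpleGraph V} {H : SimpleGraph W}
    (φ : CommonSubtreeIso G H) (wV : V → W → WithBot ℝ) (wE : Sym2 V → Sym2 W → WithBot ℝ) :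
    WithBot ℝ :=
  ∑ v : φ.dom, wV v (φ.iso v) +
    ∑ e ∈ (G.induce φ.dom).edgeFinset,
      wE (e.map Subtype.val) (e.map fun v => (φ.iso v : W))

/-- `x` is the weight of a maximum common subtree isomorphism of `G` and `H`. -/
def IsMCSTWeight {V W : Type} [Fintype V] (G : SimpleGraph V) (H : SimpleGraph W)
    (wV : V → W → WithBot ℝ) (wE : Sym2 V → Sym2 W → WithBot ℝ) (x : WithBot ℝ) : Prop :=
  IsGreatest (Set.range fun φ : CommonSubtreeIso G H => φ.weight wV wE) x

/-- `adj` is an adjacency list representation of `G`: `adj v` lists the neighbours of `v`, each of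
them once, in any order. -/
def IsAdjList {V : Type} (G : SimpleGraph V) (adj : V → List V) : Prop :=
  ∀ v, (adj v).Nodup ∧ ∀ u, u ∈ adj v ↔ G.Adj v u

/-! ### Maximum weight matchings in complete bipartite graphs -/

/-- `M` is a matching of the complete bipartite graph on `Fin k ⊎ Fin l`, given as a list of its
edges. -/
def IsMatching {k l : ℕ} (M : List (Fin k × Fin l)) : Prop :=
  (M.map Prod.fst).Nodup ∧ (M.map Prod.snd).Nodup

/-- The weight of a matching. -/
def matchingWeight {k l : ℕ} (w : Fin k → Fin l → WithBot ℝ) (M : List (Fin k × Fin l)) :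
    WithBot ℝ :=
  (M.map fun e => w e.1 e.2).sum

/-- `M` is a maximum weight matching (not necessarily a perfect one). -/
def IsMWM {k l : ℕ} (w : Fin k → Fin l → WithBot ℝ) (M : List (Fin k × Fin l)) : Prop :=
  IsMatching M ∧ ∀ M', IsMatching M' → matchingWeight w M' ≤ matchingWeight w M

/-- A procedure that takes the weights of a complete bipartite graph with parts of sizes `k` and
`l` and returns a list of edges. -/
abbrev MatchingProcedure : Type :=
  (k l : ℕ) → (Fin k → Fin l → WithBot ℝ) → Timed (List (Fin k × Fin l))

/-- The procedure `mwm` computes maximum weight matchings, in time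
`O(k l (min {k, l} + log max {k, l}))` with constant `c` (the summand `1` covers `k l = 0`). -/
structure ComputesMWM (mwm : MatchingProcedure) (c : ℝ) : Prop where
  isMWM : ∀ (k l : ℕ) (w : Fin k → Fin l → WithBot ℝ), IsMWM w (mwm k l w).val
  time_le : ∀ (k l : ℕ) (w : Fin k → Fin l → WithBot ℝ),
    ((mwm k l w).time : ℝ) ≤
      c * ((k : ℝ) * l * (min (k : ℝ) l + Real.log (max (k : ℝ) l)) + 1)

/-! ### The algorithm for maximum common subtree isomorphism -/

/-- Scan a list and remove the vertex `p` from it. If `adj v` is the list of neighbours of `v` in a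
tree and `p` is the parent of `v` (where the parent of the root is the root itself), this computes
the children of `v`. The set of children of `v` in a tree with root `s` with `s` adjacent or equal
to `v` is computed with `p = s`. -/
def removeVertex {n : ℕ} (p : Fin n) : List (Fin n) → Timed (List (Fin n))
  | [] => do
    tick 1
    pure []
  | x :: xs => do
    tick 2
    let ys ← removeVertex p xs
    pure (if x = p then ys else x :: ys)

/-- Depth first search from the vertex `u` with parent `p`, which puts the visited vertices,
together with their parents, in front of the list `acc` in the order in which they are left.
The first argument bounds the depth of the recursion. -/
def postorderAux {n : ℕ} (adj : Fin n → List (Fin n)) :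
    ℕ → Fin n → Fin n → List (Fin n × Fin n) → Timed (List (Fin n × Fin n))
  | 0, _, _, acc => pure acc
  | fuel + 1, p, u, acc => do
    let children ← removeVertex p (adj u)
    let acc' ← forEach children acc fun acc c => postorderAux adj fuel u c acc
    tick 1
    pure ((u, p) :: acc')

/-- The vertices of a tree with root `r`, together with their parents, in postorder. -/
def postorder {n : ℕ} (adj : Fin n → List (Fin n)) (r : Fin n) :
    Timed (List (Fin n × Fin n)) := do
  let rev ← postorderAux adj n r r []
  tick rev.length
  pure rev.reverse

/-- The table `D`; the entry `D u s v` is the solution of the subproblem for the subtree of the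
first tree, rooted at the fixed root, with root `u`, and the subtree with root `v` of the second
tree rooted at `s`. -/
abbrev Table (a b : ℕ) : Type := Fin a → Fin b → Fin b → WithBot ℝ

/-- Overwrite one entry of the table. -/
def Table.set {a b : ℕ} (D : Table a b) (u : Fin a) (s v : Fin b) (x : WithBot ℝ) : Table a b :=
  fun u' s' v' => if u' = u ∧ s' = s ∧ v' = v then x else D u' s' v'

/-- The solution of the subproblem with roots `u`, `v`, where `us` and `vs` are the children of `u`
and `v`, from the solutions of smaller subproblems. -/
def solveSubproblem {a b : ℕ} (mwm : MatchingProcedure) (wV : Fin a → Fin b → WithBot ℝ)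
    (wE : Sym2 (Fin a) → Sym2 (Fin b) → WithBot ℝ) (D : Table a b) (u : Fin a) (v : Fin b)
    (us : List (Fin a)) (vs : List (Fin b)) : Timed (WithBot ℝ) := do
  tick 1
  if wV u v = ⊥ then
    pure ⊥
  else do
    -- the two lists are copied to arrays
    tick (us.length + vs.length)
    let w ← tabulate fun i : Fin us.length => tabulate fun j : Fin vs.length => do
      tick 3
      pure (wE s(u, us.get i) s(v, vs.get j) + D (us.get i) v (vs.get j))
    let M ← mwm us.length vs.length w
    let W ← forEach M 0 fun x e => do
      tick 2
      pure (x + w e.1 e.2)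
    tick 2
    pure (wV u v + W)

/-- The algorithm for maximum common subtree isomorphism, for a tree on `Fin a` and a tree on
`Fin b` with adjacency lists `adjG` and `adjH`, with weights `wV` of pairs of vertices and `wE` of
pairs of edges, with the root `r` of the first tree, and with the procedure `mwm` for maximum
weight matchings. -/
def maxCommonSubtree {a b : ℕ} (mwm : MatchingProcedure) (adjG : Fin a → List (Fin a))
    (adjH : Fin b → List (Fin b)) (wV : Fin a → Fin b → WithBot ℝ)
    (wE : Sym2 (Fin a) → Sym2 (Fin b) → WithBot ℝ) (r : Fin a) : Timed (WithBot ℝ) := do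
  -- allocation of the table
  tick (a * b * b)
  let order ← postorder adjG r
  let D ← forEach order (fun _ _ _ => ⊥ : Table a b) fun D up => do
    let us ← removeVertex up.2 (adjG up.1)
    forEach (List.finRange b) D fun D v =>
      forEach (v :: adjH v) D fun D s => do
        let vs ← removeVertex s (adjH v)
        let x ← solveSubproblem mwm wV wE D up.1 v us vs
        tick 1
        pure (Table.set D up.1 s v x)
  -- the maximum entry of the table
  forEach (List.finRange a) ⊥ fun best u =>
    forEach (List.finRange b) best fun best v =>
      forEach (v :: adjH v) best fun best s => do
        tick 2
        pure (max best (D u s v))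

/-- With the procedure `mwm` for maximum weight matchings, the algorithm computes the weight of a
maximum common subtree isomorphism of any two trees `G` and `H` of orders `a` and `b`, for all
weights, all adjacency list representations of the trees and all choices of the root, within
`C (a + b) ^ 4` steps. -/
def SolvesMCSTInQuarticTime (mwm : MatchingProcedure) (C : ℝ) : Prop :=
  ∀ (a b : ℕ) (G : SimpleGraph (Fin a)) (H : SimpleGraph (Fin b)),
    G.IsTree → H.IsTree →
    ∀ (adjG : Fin a → List (Fin a)) (adjH : Fin b → List (Fin b)),
      IsAdjList G adjG → IsAdjList H adjH →
      ∀ (wV : Fin a → Fin b → WithBot ℝ) (wE : Sym2 (Fin a) → Sym2 (Fin b) → WithBot ℝ)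
        (r : Fin a),
        IsMCSTWeight G H wV wE (maxCommonSubtree mwm adjG adjH wV wE r).val ∧
        ((maxCommonSubtree mwm adjG adjH wV wE r).time : ℝ) ≤ C * ((a : ℝ) + b) ^ 4

/-! ### A procedure for maximum weight matchings: the Hungarian method

Rows are the elements of `Fin k` and columns those of `Fin l`, where `k ≤ l`. -/

namespace Hungarian

/-- A matching, as the mutually inverse partial maps between rows and columns. -/
structure Mates (k l : ℕ) where
  rowMate : Fin k → Option (Fin l)
  colMate : Fin l → Option (Fin k)

/-- The data of the search for an augmenting path: dual values `y`, `z`; the rows and columns of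
the alternating tree; for each column outside the tree the minimum slack `y i + z j - w i j` over
the rows `i` of the tree; and for each column a row of the tree that attains (for a column of the
tree: attained, when the column was added) this minimum. -/
structure Search (k l : ℕ) where
  y : Fin k → ℝ
  z : Fin l → ℝ
  inRow : Fin k → Bool
  inCol : Fin l → Bool
  slack : Fin l → ℝ
  pred : Fin l → Fin k

/-- A column outside the tree with minimum slack, if there is any column outside the tree. -/
def argmin {l : ℕ} (slack : Fin l → ℝ) (inCol : Fin l → Bool) : Timed (Option (Fin l)) :=
  forEach (List.finRange l) none fun best j => do
    tick 3
    pure (if inCol j then best else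
      match best with
      | none => some j
      | some j' => if slack j < slack j' then some j else some j')

/-- Change the dual values until an edge to a column outside the tree becomes tight, and add this
column with its mate to the tree, until an unmatched column is reached, which is returned. -/
def search {k l : ℕ} (w : Fin k → Fin l → ℝ) (colMate : Fin l → Option (Fin k)) :
    ℕ → Search k l → Timed (Search k l × Option (Fin l))
  | 0, t => pure (t, none)
  | fuel + 1, t => do
    let best ← argmin t.slack t.inCol
    match best with
    | none => pure (t, none)
    | some j => do
      let d := t.slack j
      let y ← tabulate fun i => do
        tick 2
        pure (if t.inRow i then t.y i - d else t.y i)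
      let z ← tabulate fun j' => do
        tick 2
        pure (if t.inCol j' then t.z j' + d else t.z j')
      let slack ← tabulate fun j' => do
        tick 2
        pure (if t.inCol j' then t.slack j' else t.slack j' - d)
      tick 1
      match colMate j with
      | none => pure ({ t with y := y, z := z, slack := slack }, some j)
      | some i => do
        tick 2
        let inRow := Function.update t.inRow i true
        let inCol := Function.update t.inCol j true
        let new ← tabulate fun j' => do
          tick 5
          pure (if inCol j' then (slack j', t.pred j')
            else if y i + z j' - w i j' < slack j' then (y i + z j' - w i j', i)
            else (slack j', t.pred j'))
        search w colMate fuel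
          { y := y, z := z, inRow := inRow, inCol := inCol
            slack := fun j' => (new j').1, pred := fun j' => (new j').2 }

/-- Augment the matching along the path from the column `j` back to the unmatched row. -/
def augment {k l : ℕ} (pred : Fin l → Fin k) : ℕ → Fin l → Mates k l → Timed (Mates k l)
  | 0, _, m => pure m
  | fuel + 1, j, m => do
    tick 4
    let i := pred j
    let m' : Mates k l :=
      { rowMate := Function.update m.rowMate i (some j)
        colMate := Function.update m.colMate j (some i) }
    match m.rowMate i with
    | none => pure m'
    | some j' => augment pred fuel j' m'

/-- Dual values together with a matching. -/
structure State (k l : ℕ) where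
  y : Fin k → ℝ
  z : Fin l → ℝ
  mates : Mates k l

/-- One phase of the method: match one more row, the row `i`. -/
def phase {k l : ℕ} (w : Fin k → Fin l → ℝ) (st : State k l) (i : Fin k) :
    Timed (State k l) := do
  let slack ← tabulate fun j => do
    tick 4
    pure (st.y i + st.z j - w i j)
  let inRow ← tabulate fun i' => pure (decide (i' = i))
  let inCol ← tabulate fun _ : Fin l => pure false
  let pred ← tabulate fun _ : Fin l => pure i
  let res ← search w st.mates.colMate k
    { y := st.y, z := st.z, inRow := inRow, inCol := inCol, slack := slack, pred := pred }
  match res.2 with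
  | none => pure st
  | some j => do
    let mates ← augment res.1.pred k j st.mates
    pure { y := res.1.y, z := res.1.z, mates := mates }

/-- A maximum weight assignment of all rows to columns, for nonnegative weights and `k ≤ l`. -/
def assignment {k l : ℕ} (w : Fin k → Fin l → ℝ) : Timed (Fin k → Option (Fin l)) := do
  let y ← tabulate fun i => forEach (List.finRange l) 0 fun x j => do
    tick 2
    pure (max x (w i j))
  let z ← tabulate fun _ : Fin l => pure 0
  let rowMate ← tabulate fun _ : Fin k => pure none
  let colMate ← tabulate fun _ : Fin l => pure none
  let st ← forEach (List.finRange k)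
    { y := y, z := z, mates := { rowMate := rowMate, colMate := colMate } } (phase w)
  pure st.mates.rowMate

/-- A maximum weight matching for `k ≤ l`: negative weights are replaced by `0`, all rows are
assigned to columns with maximum weight, and only the edges of positive weight are kept. -/
def mwmOfLE {k l : ℕ} (w : Fin k → Fin l → WithBot ℝ) : Timed (List (Fin k × Fin l)) := do
  tick 1
  if k = 0 then
    pure []
  else do
    let w' ← tabulate fun i => tabulate fun j => do
      tick 1
      pure (max ((w i j).unbotD 0) 0)
    let rowMate ← assignment w'
    forEach (List.finRange k) [] fun M i => do
      tick 3
      pure (match rowMate i with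
        | none => M
        | some j => if 0 < w i j then (i, j) :: M else M)

/-- The Hungarian method for maximum weight matchings; if `l < k`, the two sides are exchanged. -/
def mwm : MatchingProcedure := fun k l w => do
  tick 1
  if k ≤ l then
    mwmOfLE w
  else do
    let w' ← tabulate fun j => tabulate fun i => do
      tick 1
      pure (w i j)
    let M ← mwmOfLE w'
    tick M.length
    pure (M.map Prod.swap)

end Hungarian

end TreeMCS

end

noncomputable section
namespace TreeMCS

/-! ### Values and running times of the basic program constructs -/

section Timed

variable {α β ι σ : Type}

/-! Correctness of the dynamic program. In a tree, a single edge leaves the branch at a child of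
`u`, namely the edge to `u` (`branch_crossing`). Hence an embedding of a subtree with topmost vertex
`u`, sent to `v`, splits into the pair `u`, `v` and embeddings of the pieces in the branches at the
children of `u`. The image of each piece stays in one branch at `v` (`IsEmb.restrict`), and
injectivity gives distinct pieces distinct branches, so the pieces define a matching between
children. Conversely, optimal embeddings chosen along a matching can be glued
(`exists_glued_isEmb`). Weights add up under this splitting (`embWeight_decomp`), so the best
embedding is worth the weight of `u`, `v` plus that of a maximum weight matching
(`solveSubproblem_spec`); postorder supplies the entries of the children. Embeddings are the same as
common subtree isomorphisms: an injective homomorphism from a subtree into a tree reflects adjacency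
(`adj_of_map_adj`), and an isomorphism becomes an embedding rooted at its vertex nearest to `r`,
with `s = v` (`CommonSubtreeIso.exists_isEmb`).

Running time. Let `A` and `B` be the degrees of `u` and `v` plus one. One entry costs `O(A B n)`,
and `B` values of `s` occur, so `v` contributes `O(A B² n)`. One factor `B` is bounded by `n`; the
remaining `A` and `B` are summed over the vertices, giving at most `3n` each by the handshake lemma.
The product is `O(n⁴)`.

Hungarian method. Feasible nonnegative dual values are kept together with a matching on tight edges
such that unmatched columns have dual value `0`. A phase grows an alternating tree of tight edges
from an unmatched row, lowering the dual values of its rows and raising those of its columns, until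
an unmatched column is reached (`search_spec`); augmenting matches one more row (`augment_spec`).
When all rows are matched, the dual value equals the weight of the assignment, and weak duality
(`sum_matching_le`) shows optimality. With `k` phases of at most `k` rounds of cost `O(l)`, the time
is `O(k² l)` for `k ≤ l`. -/

@[simp] theorem pure_val (a : α) : (pure a : Timed α).val = a := rfl

@[simp] theorem pure_time (a : α) : (pure a : Timed α).time = 0 := rfl

@[simp] theorem bind_val (x : Timed α) (f : α → Timed β) : (x >>= f).val = (f x.val).val := rfl

@[simp] theorem bind_time (x : Timed α) (f : α → Timed β) :
    (x >>= f).time = x.time + (f x.val).time := rfl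

@[simp] theorem tick_time (n : ℕ) : (tick n).time = n := rfl

theorem tabulate_val {n : ℕ} (f : Fin n → Timed α) :
    (tabulate f).val = fun i => (f i).val := rfl

theorem tabulate_time {n : ℕ} (f : Fin n → Timed α) :
    (tabulate f).time = ∑ i, ((f i).time + 1) := rfl

theorem tabulate_time_le {n : ℕ} (f : Fin n → Timed α) (c : ℕ) (h : ∀ i, (f i).time ≤ c) :
    (tabulate f).time ≤ n * (c + 1) := by
  rw [tabulate_time]
  calc ∑ i, ((f i).time + 1) ≤ ∑ _i : Fin n, (c + 1) :=
        Finset.sum_le_sum fun i _ => Nat.add_le_add_right (h i) 1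
    _ = n * (c + 1) := by simp

@[simp] theorem forEach_nil (st : σ) (body : σ → ι → Timed σ) :
    forEach [] st body = pure st := rfl

@[simp] theorem forEach_cons_val (x : ι) (xs : List ι) (st : σ) (body : σ → ι → Timed σ) :
    (forEach (x :: xs) st body).val = (forEach xs (body st x).val body).val := rfl

@[simp] theorem forEach_cons_time (x : ι) (xs : List ι) (st : σ) (body : σ → ι → Timed σ) :
    (forEach (x :: xs) st body).time =
      1 + ((body st x).time + (forEach xs (body st x).val body).time) := rfl

theorem forEach_append_val (xs ys : List ι) (st : σ) (body : σ → ι → Timed σ) :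
    (forEach (xs ++ ys) st body).val = (forEach ys (forEach xs st body).val body).val := by
  induction xs generalizing st with
  | nil => rfl
  | cons x xs ih => exact ih _

theorem forEach_time_le (xs : List ι) (st : σ) (body : σ → ι → Timed σ) (c : ι → ℕ)
    (h : ∀ x ∈ xs, ∀ s, (body s x).time ≤ c x) :
    (forEach xs st body).time ≤ (xs.map fun x => c x + 1).sum := by
  induction xs generalizing st with
  | nil => simp
  | cons x xs ih =>
    have h1 := h x (by simp) st
    have h2 := ih (body st x).val fun y hy => h y (by simp [hy])
    simp only [forEach_cons_time, List.map_cons, List.sum_cons]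
    omega

theorem forEach_time_le_const (xs : List ι) (st : σ) (body : σ → ι → Timed σ) (c : ℕ)
    (h : ∀ x ∈ xs, ∀ s, (body s x).time ≤ c) :
    (forEach xs st body).time ≤ xs.length * (c + 1) := by
  refine (forEach_time_le xs st body (fun _ => c) h).trans ?_
  simp

theorem removeVertex_val {n : ℕ} (p : Fin n) (xs : List (Fin n)) :
    (removeVertex p xs).val = xs.filter (· ≠ p) := by
  induction xs with
  | nil => rfl
  | cons x xs ih =>
    simp only [removeVertex, bind_val, pure_val, ih]
    by_cases h : x = p <;> simp [h]

theorem removeVertex_time {n : ℕ} (p : Fin n) (xs : List (Fin n)) :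
    (removeVertex p xs).time = 2 * xs.length + 1 := by
  induction xs with
  | nil => rfl
  | cons x xs ih =>
    simp only [removeVertex, bind_time, pure_time, tick_time, ih, List.length_cons]
    omega

theorem removeVertex_length_le {n : ℕ} (p : Fin n) (xs : List (Fin n)) :
    (removeVertex p xs).val.length ≤ xs.length := by
  rw [removeVertex_val]
  exact List.length_filter_le _ _

end Timed

/-! ### The Hungarian method -/

namespace Hungarian

/-- The rank `ρ` drops along the path from `j` to the root, so the path is simple and the recursion
ends within the fuel. For the induction the two partial maps are inverse only away from `j`: after a
step, the column that has just lost its row still carries a stale `colMate`, which the next step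
overwrites. -/
theorem augment_spec {k l : ℕ} (pred : Fin l → Fin k) (T : Fin k → Fin l → Prop) (i₀ : Fin k)
    (ρ : Fin l → ℕ) (fuel : ℕ) (j : Fin l) (m : Mates k l) (hfuel : ρ j < fuel)
    (hcon : ∀ j', j' ≠ j → ∀ i, m.rowMate i = some j' ↔ m.colMate j' = some i)
    (hfree : ∀ i, m.rowMate i ≠ some j)
    (htight : ∀ i j', m.rowMate i = some j' → T i j')
    (hpred : ∀ j', ρ j' ≤ ρ j → T (pred j') j')
    (hpath : ∀ j₁, ρ j₁ ≤ ρ j → ∀ j₂, m.rowMate (pred j₁) = some j₂ → ρ j₂ < ρ j₁)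
    (hend : ∀ j', ρ j' ≤ ρ j → m.rowMate (pred j') = none → pred j' = i₀) :
    (∀ i j', (augment pred fuel j m).val.rowMate i = some j' ↔
      (augment pred fuel j m).val.colMate j' = some i) ∧
    (∀ i j', (augment pred fuel j m).val.rowMate i = some j' → T i j') ∧
    (∀ i, (augment pred fuel j m).val.rowMate i ≠ none ↔ m.rowMate i ≠ none ∨ i = i₀) ∧
    (∀ j', m.colMate j' ≠ none → (augment pred fuel j m).val.colMate j' ≠ none) := by
  induction fuel generalizing j m with
  | zero => omega
  | succ fuel ih =>
    cases hm : m.rowMate (pred j) with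
    | none =>
      have hi := hend j le_rfl hm
      simp only [augment, bind_val, hm, pure_val]
      refine ⟨?_, ?_, ?_, ?_⟩
      · intro i j'
        have h1 := hfree i
        by_cases hj : j' = j
        · subst hj
          by_cases h : i = pred j' <;> grind [Function.update_apply]
        · have := hcon j' hj i
          by_cases h : i = pred j <;> grind [Function.update_apply]
      · intro i j' h
        by_cases hh : i = pred j
        · have := hpred j le_rfl
          grind [Function.update_apply]
        · grind [Function.update_apply]
      · intro i
        grind [Function.update_apply]
      · intro i h
        grind [Function.update_apply]
    | some j' =>
      simp only [augment, bind_val, hm]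
      have hlt := hpath j le_rfl j' hm
      -- A second visit to the row `pred j` would lead to `j'` again, forcing `ρ j' < ρ j'`. So the
      -- update at this row is invisible to the rest of the path.
      have hne : ∀ j₂, ρ j₂ ≤ ρ j' → pred j₂ ≠ pred j := by
        intro j₂ h2 h
        have := hpath j₂ (by omega) j' (h ▸ hm)
        omega
      have hjj : j' ≠ j := by rintro rfl; exact hfree _ hm
      have hcj := (hcon j' hjj (pred j)).1 hm
      obtain ⟨h1, h2, h3, h4⟩ := ih j'
        { rowMate := Function.update m.rowMate (pred j) (some j)
          colMate := Function.update m.colMate j (some (pred j)) } (by omega)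
        (by
          intro j₂ h2 i
          have h1 := hfree i
          by_cases hj : j₂ = j
          · grind [Function.update_apply]
          · have := hcon j₂ hj i
            grind [Function.update_apply])
        (by
          intro i
          have h1 := hfree i
          have := hcon j' hjj i
          grind [Function.update_apply])
        (by
          intro i j₂ h
          have := hpred j le_rfl
          grind [Function.update_apply])
        (fun j₂ h => hpred j₂ (by omega))
        (by
          intro j₁ h j₂ h2
          refine hpath j₁ (by omega) j₂ ?_
          simpa [Function.update_apply, hne j₁ h] using h2)
        (by
          intro j₁ h h2
          refine hend j₁ (by omega) ?_
          simpa [Function.update_apply, hne j₁ h] using h2)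
      refine ⟨h1, h2, fun i => (h3 i).trans ?_, fun j₂ h => h4 j₂ ?_⟩
      · grind [Function.update_apply]
      · grind [Function.update_apply]

theorem augment_time_le {k l : ℕ} (pred : Fin l → Fin k) (fuel : ℕ) (j : Fin l) (m : Mates k l) :
    (augment pred fuel j m).time ≤ 4 * fuel := by
  induction fuel generalizing j m with
  | zero => simp [augment]
  | succ fuel ih =>
    cases hm : m.rowMate (pred j) with
    | none => simp [augment, hm]
    | some j' =>
      have := ih j' { rowMate := Function.update m.rowMate (pred j) (some j)
                      colMate := Function.update m.colMate j (some (pred j)) }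
      simp only [augment, hm, bind_time, tick_time]
      omega

/-! ### The search for an augmenting path -/

theorem forEach_argmin_spec {l : ℕ} (slack : Fin l → ℝ) (inCol : Fin l → Bool)
    (body : Option (Fin l) → Fin l → Timed (Option (Fin l)))
    (hbody : ∀ b j, (body b j).val = if inCol j then b else
      some (b.elim j fun j' => if slack j < slack j' then j else j')) (xs : List (Fin l)) :
    ((forEach xs none body).val = none → ∀ j ∈ xs, inCol j = true) ∧
    ∀ j, (forEach xs none body).val = some j →
      inCol j = false ∧ ∀ j' ∈ xs, inCol j' = false → slack j ≤ slack j' := by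
  induction xs using List.reverseRecOn with
  | nil => simp
  | append_singleton xs x ih =>
    simp only [forEach_append_val, forEach_cons_val, forEach_nil, pure_val, hbody] at ih ⊢
    obtain ⟨h1, h2⟩ := ih
    generalize (forEach xs none body).val = r at h1 h2 ⊢
    by_cases hx : inCol x = true
    · simp only [hx, if_true]
      constructor
      · intro h j hj
        grind
      · intro j hj
        refine ⟨(h2 j hj).1, fun j' hj' hc => ?_⟩
        have := (h2 j hj).2 j'
        grind
    · cases r with
      | none =>
        have h1 := h1 rfl
        simp only [hx]
        constructor
        · simp
        · intro j hj
          simp at hj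
          subst hj
          refine ⟨by simpa using hx, fun j' hj' hc => ?_⟩
          rcases List.mem_append.1 hj' with h | h
          · simp [h1 j' h] at hc
          · simp at h; simp [h]
      | some b =>
        simp only [hx]
        obtain ⟨h3, h4⟩ := h2 b rfl
        constructor
        · intro h
          simp at h
        · intro j hj
          by_cases hlt : slack x < slack b
          · have : x = j := by simpa [hlt] using hj
            subst this
            refine ⟨by simpa using hx, fun j' hj' hc => ?_⟩
            rcases List.mem_append.1 hj' with h | h
            · exact hlt.le.trans (h4 j' h hc)
            · simp at h; simp [h]
          · have : b = j := by simpa [hlt] using hj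
            subst this
            refine ⟨h3, fun j' hj' hc => ?_⟩
            rcases List.mem_append.1 hj' with h | h
            · exact h4 j' h hc
            · simp at h; subst h; linarith

theorem argmin_spec {l : ℕ} (slack : Fin l → ℝ) (inCol : Fin l → Bool) :
    ((argmin slack inCol).val = none → ∀ j, inCol j = true) ∧
    ∀ j, (argmin slack inCol).val = some j →
      inCol j = false ∧ ∀ j', inCol j' = false → slack j ≤ slack j' := by
  have := forEach_argmin_spec slack inCol (fun best j => do
    tick 3
    pure (if inCol j then best else
      match best with
      | none => some j
      | some j' => if slack j < slack j' then some j else some j')) (fun b j => by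
        cases b with
        | none => rfl
        | some j' => simp only [bind_val, pure_val, Option.elim]; split_ifs <;> rfl) (List.finRange l)
  simp only [List.mem_finRange, true_imp_iff] at this
  exact this

theorem argmin_time_le {l : ℕ} (slack : Fin l → ℝ) (inCol : Fin l → Bool) :
    (argmin slack inCol).time ≤ l * 4 := by
  unfold argmin
  refine (forEach_time_le_const _ _ _ 3 ?_).trans (by simp)
  intro x _ s
  simp

/-- The invariant of the search for an augmenting path that starts from the row `i₀`; the number
`ρ j` is the position at which the column `j` was added to the tree. -/
structure SearchInv {k l : ℕ} (w : Fin k → Fin l → ℝ) (colMate : Fin l → Option (Fin k))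
    (i₀ : Fin k) (t : Search k l) (ρ : Fin l → ℕ) : Prop where
  feas : ∀ i j, w i j ≤ t.y i + t.z j
  zn : ∀ j, 0 ≤ t.z j
  free : ∀ j, colMate j = none → t.z j = 0
  tight : ∀ i j, colMate j = some i → t.y i + t.z j = w i j
  root : t.inRow i₀ = true
  col : ∀ j, t.inCol j = true → ∃ i, colMate j = some i ∧ t.inRow i = true
  row : ∀ i, t.inRow i = true → i = i₀ ∨ ∃ j, t.inCol j = true ∧ colMate j = some i
  slack_le : ∀ j, t.inCol j = false → ∀ i, t.inRow i = true → t.slack j ≤ t.y i + t.z j - w i j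
  pred_in : ∀ j, t.inRow (t.pred j) = true
  pred_slack : ∀ j, t.inCol j = false → t.slack j = t.y (t.pred j) + t.z j - w (t.pred j) j
  pred_tight : ∀ j, t.inCol j = true → t.y (t.pred j) + t.z j = w (t.pred j) j
  rank_lt : ∀ j, t.inCol j = true → ρ j < (Finset.univ.filter fun j => t.inCol j = true).card
  rank_path : ∀ j, t.inCol j = true → ∀ j', colMate j' = some (t.pred j) → ρ j' < ρ j
  card_eq : (Finset.univ.filter fun j => t.inCol j = true).card + 1 =
    (Finset.univ.filter fun i => t.inRow i = true).card

/-- What the search for an augmenting path from the row `i₀` returns: feasible dual values for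
which the path that is described by `pred` from the column `j` to the row `i₀` is tight. -/
structure SearchResult {k l : ℕ} (w : Fin k → Fin l → ℝ) (colMate : Fin l → Option (Fin k))
    (i₀ : Fin k) (t : Search k l) (j : Fin l) (ρ : Fin l → ℕ) : Prop where
  feas : ∀ i j, w i j ≤ t.y i + t.z j
  zn : ∀ j, 0 ≤ t.z j
  free : ∀ j, colMate j = none → t.z j = 0
  tight : ∀ i j, colMate j = some i → t.y i + t.z j = w i j
  unmatched : colMate j = none
  rank_lt : ρ j < k
  pred_tight : ∀ j', ρ j' ≤ ρ j → t.y (t.pred j') + t.z j' = w (t.pred j') j'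
  rank_path : ∀ j₁, ρ j₁ ≤ ρ j → ∀ j₂, colMate j₂ = some (t.pred j₁) → ρ j₂ < ρ j₁
  root : ∀ j', ρ j' ≤ ρ j → (∀ j₂, colMate j₂ ≠ some (t.pred j')) → t.pred j' = i₀

variable {k l : ℕ} {w : Fin k → Fin l → ℝ} {colMate : Fin l → Option (Fin k)} {i₀ : Fin k}

/-- The search data after the dual change by the minimum slack `d`. -/
def Search.change (t : Search k l) (d : ℝ) : Search k l where
  y i := if t.inRow i then t.y i - d else t.y i
  z j := if t.inCol j then t.z j + d else t.z j
  inRow := t.inRow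
  inCol := t.inCol
  slack j := if t.inCol j then t.slack j else t.slack j - d
  pred := t.pred

/-- The search data after the column `j` with its mate `i` has been added to the tree. -/
def Search.grow (w : Fin k → Fin l → ℝ) (t : Search k l) (j : Fin l) (i : Fin k) : Search k l where
  y := t.y
  z := t.z
  inRow := Function.update t.inRow i true
  inCol := Function.update t.inCol j true
  slack j' := if Function.update t.inCol j true j' then t.slack j'
    else if t.y i + t.z j' - w i j' < t.slack j' then t.y i + t.z j' - w i j' else t.slack j'
  pred j' := if Function.update t.inCol j true j' then t.pred j'
    else if t.y i + t.z j' - w i j' < t.slack j' then i else t.pred j'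

/-- Separates the program from the mathematics: a round is a dual change, followed by growing the
tree unless the column is unmatched. The invariant can then be checked for each operation alone. -/
theorem search_succ (fuel : ℕ) (t : Search k l) :
    (search w colMate (fuel + 1) t).val =
      match (argmin t.slack t.inCol).val with
      | none => (t, none)
      | some j => match colMate j with
        | none => (t.change (t.slack j), some j)
        | some i => (search w colMate fuel ((t.change (t.slack j)).grow w j i)).val := by
  conv_lhs => unfold search
  simp only [bind_val]
  cases h : (argmin t.slack t.inCol).val with
  | none => rfl
  | some j =>
    simp only [bind_val]
    cases h2 : colMate j with
    | none => rfl
    | some i =>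
      simp only [bind_val]
      congr 2
      simp only [Search.grow, Search.change, tabulate_val, bind_val, pure_val, Search.mk.injEq,
        true_and]
      constructor <;> funext j' <;> split_ifs <;> rfl

/-- Edges inside the tree keep their slack, edges from a tree row to an outside column lose `d`,
which is at most their slack, and edges from an outside row to a tree column gain `d ≥ 0`. Matched
edges stay tight because, the root being unmatched, a matched row lies in the tree exactly when its
column does. Unmatched columns are never in the tree, so their dual value remains `0`. -/
theorem SearchInv.change {t : Search k l} {ρ : Fin l → ℕ} (h : SearchInv w colMate i₀ t ρ)
    (hinj : ∀ i j j', colMate j = some i → colMate j' = some i → j = j')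
    (hroot : ∀ j, colMate j ≠ some i₀)
    {j : Fin l} (hj : t.inCol j = false) (hmin : ∀ j', t.inCol j' = false → t.slack j ≤ t.slack j') :
    SearchInv w colMate i₀ (t.change (t.slack j)) ρ := by
  have hd : 0 ≤ t.slack j := by
    rw [h.pred_slack j hj]; linarith [h.feas (t.pred j) j]
  constructor
  · intro i j'
    have h1 := h.feas i j'
    simp only [Search.change]
    by_cases hi : t.inRow i = true <;> by_cases hc : t.inCol j' = true
    · simp [hi, hc]; linarith
    · simp only [Bool.not_eq_true] at hc
      have := h.slack_le j' hc i hi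
      have := hmin j' hc
      simp [hi, hc]; linarith
    · simp [hi, hc]; linarith
    · simp [hi, hc]; linarith
  · intro j'
    have := h.zn j'
    simp only [Search.change]
    split_ifs <;> linarith
  · intro j' hf
    have hc : ¬ t.inCol j' = true := by
      intro hc
      obtain ⟨i, hi, _⟩ := h.col j' hc
      simp [hf] at hi
    simp [Search.change, hc, h.free j' hf]
  · intro i j' hm
    have h1 := h.tight i j' hm
    simp only [Search.change]
    by_cases hc : t.inCol j' = true
    · obtain ⟨i', hi', hr⟩ := h.col j' hc
      obtain rfl : i = i' := by simpa [hm] using hi'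
      simp [hc, hr]; linarith
    · have hr : ¬ t.inRow i = true := by
        intro hr
        rcases h.row i hr with rfl | ⟨j'', hc', hm'⟩
        · exact hroot _ hm
        · exact hc (hinj _ _ _ hm hm' ▸ hc')
      simp [hc, hr]; linarith
  · exact h.root
  · exact h.col
  · exact h.row
  · intro j' hc i hi
    have hc : t.inCol j' = false := hc
    have hi : t.inRow i = true := hi
    have := h.slack_le j' hc i hi
    simp [Search.change, hc, hi]
    linarith
  · exact h.pred_in
  · intro j' hc
    have hc : t.inCol j' = false := hc
    have := h.pred_slack j' hc
    simp [Search.change, hc, h.pred_in j', this]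
    ring
  · intro j' hc
    have hc : t.inCol j' = true := hc
    have := h.pred_tight j' hc
    simp [Search.change, hc, h.pred_in j']
    linarith
  · exact h.rank_lt
  · exact h.rank_path
  · exact h.card_eq

theorem card_filter_update {n : ℕ} (f : Fin n → Bool) (a : Fin n) (h : f a = false) :
    (Finset.univ.filter fun b => Function.update f a true b = true).card =
      (Finset.univ.filter fun b => f b = true).card + 1 := by
  rw [← Finset.card_insert_of_notMem (a := a) (by simp [h])]
  congr 1
  ext b
  by_cases hb : b = a <;> simp [Function.update_apply, hb]

/-- Slack `0` says that the edge from `pred j` to `j` is tight. The mate `i` is a new row, since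
each tree row other than the root entered with its own column. The new column gets as rank the
previous number of tree columns, which exceeds all ranks in the tree. -/
theorem SearchInv.grow {t : Search k l} {ρ : Fin l → ℕ} (h : SearchInv w colMate i₀ t ρ)
    (hinj : ∀ i j j', colMate j = some i → colMate j' = some i → j = j')
    (hroot : ∀ j, colMate j ≠ some i₀)
    {j : Fin l} (hj : t.inCol j = false) (hs : t.slack j = 0) {i : Fin k}
    (hm : colMate j = some i) :
    SearchInv w colMate i₀ (t.grow w j i)
      (Function.update ρ j (Finset.univ.filter fun j => t.inCol j = true).card) := by
  have hi : t.inRow i = false := by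
    by_contra hr
    simp only [Bool.not_eq_false] at hr
    rcases h.row i hr with rfl | ⟨j'', hc', hm'⟩
    · exact hroot _ hm
    · rw [← hinj _ _ _ hm hm', hj] at hc'
      cases hc'
  have hmono : ∀ i', t.inRow i' = true → Function.update t.inRow i true i' = true := by
    intro i' h'
    by_cases hh : i' = i <;> simp [hh, h']
  have hcard := card_filter_update _ _ hj
  constructor
  · exact h.feas
  · exact h.zn
  · exact h.free
  · exact h.tight
  · exact hmono _ h.root
  · intro j' hc
    by_cases hjj : j' = j
    · subst hjj
      exact ⟨i, hm, by simp [Search.grow]⟩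
    · obtain ⟨i', h1, h2⟩ := h.col j' (by simpa [Search.grow, Function.update_apply, hjj] using hc)
      exact ⟨i', h1, hmono _ h2⟩
  · intro i' hr
    by_cases hii : i' = i
    · subst hii
      exact Or.inr ⟨j, by simp [Search.grow], hm⟩
    · rcases h.row i' (by simpa [Search.grow, Function.update_apply, hii] using hr) with h1 | ⟨j', h1, h2⟩
      · exact Or.inl h1
      · refine Or.inr ⟨j', ?_, h2⟩
        by_cases hjj : j' = j <;> simp [Search.grow, Function.update_apply, hjj, h1]
  · intro j' hc i' hr
    have hjj : j' ≠ j := by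
      rintro rfl
      simp [Search.grow] at hc
    have hc' : t.inCol j' = false := by simpa [Search.grow, Function.update_apply, hjj] using hc
    simp only [Search.grow, Function.update_apply, hjj, hc', if_false]
    by_cases hii : i' = i
    · subst hii
      simp only [Bool.false_eq_true, if_false]
      split_ifs <;> linarith
    · have := h.slack_le j' hc' i' (by simpa [Search.grow, Function.update_apply, hii] using hr)
      simp only [Bool.false_eq_true, if_false]
      split_ifs <;> linarith
  · intro j'
    simp only [Search.grow]
    split_ifs
    · exact hmono _ (h.pred_in _)
    · simp
    · exact hmono _ (h.pred_in _)
  · intro j' hc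
    have hc : Function.update t.inCol j true j' = false := hc
    have hjj : j' ≠ j := by
      rintro rfl
      simp at hc
    have hc' : t.inCol j' = false := by simpa [Function.update_apply, hjj] using hc
    have := h.pred_slack j' hc'
    simp only [Search.grow, hc, Bool.false_eq_true, if_false]
    split_ifs
    · rfl
    · exact this
  · intro j' hc
    have hc : Function.update t.inCol j true j' = true := hc
    simp only [Search.grow, hc, if_true]
    by_cases hjj : j' = j
    · subst hjj
      have := h.pred_slack j' hj
      linarith
    · exact h.pred_tight j' (by simpa [Function.update_apply, hjj] using hc)
  · intro j' hc
    have hc : Function.update t.inCol j true j' = true := hc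
    refine lt_of_lt_of_eq ?_ hcard.symm
    by_cases hjj : j' = j
    · simp [hjj]
    · have := h.rank_lt j' (by simpa [Function.update_apply, hjj] using hc)
      simp only [Function.update_apply, hjj, if_false]
      omega
  · intro j' hc j₂ hm₂
    have hc : Function.update t.inCol j true j' = true := hc
    simp only [Search.grow, hc, if_true] at hm₂
    have hj₂ : t.inCol j₂ = true := by
      rcases h.row _ (h.pred_in j') with h1 | ⟨j₃, h1, h2⟩
      · exact absurd (h1 ▸ hm₂) (hroot _)
      · rwa [hinj _ _ _ hm₂ h2]
    have hne : j₂ ≠ j := by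
      rintro rfl
      simp [hj] at hj₂
    by_cases hjj : j' = j
    · have := h.rank_lt j₂ hj₂
      simpa [Function.update_apply, hjj, hne] using this
    · have := h.rank_path j' (by simpa [Function.update_apply, hjj] using hc) j₂ hm₂
      simpa [Function.update_apply, hjj, hne] using this
  · exact (congrArg (· + 1) hcard).trans
      ((congrArg (· + 1) h.card_eq).trans (card_filter_update _ _ hi).symm)

/-- The tree has one more row than columns. Since `k ≤ l`, its columns cannot be all columns, so
`argmin` finds one. Each round that does not stop adds a row; as fuel plus the number of tree rows
is `k + 1`, the fuel cannot run out first. -/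
theorem search_spec (hkl : k ≤ l)
    (hinj : ∀ i j j', colMate j = some i → colMate j' = some i → j = j')
    (hroot : ∀ j, colMate j ≠ some i₀) (fuel : ℕ) (t : Search k l) (ρ : Fin l → ℕ)
    (h : SearchInv w colMate i₀ t ρ)
    (hfuel : fuel + (Finset.univ.filter fun i => t.inRow i = true).card = k + 1) :
    ∃ j ρ', (search w colMate fuel t).val.2 = some j ∧
      SearchResult w colMate i₀ (search w colMate fuel t).val.1 j ρ' := by
  have hcard := h.card_eq
  have hle : (Finset.univ.filter fun i => t.inRow i = true).card ≤ k :=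
    (Finset.card_le_univ _).trans (by simp)
  induction fuel generalizing t ρ with
  | zero => omega
  | succ fuel ih =>
    rw [search_succ]
    obtain ⟨hnone, hsome⟩ := argmin_spec t.slack t.inCol
    cases hb : (argmin t.slack t.inCol).val with
    | none =>
      have := hnone hb
      simp [this] at hcard
      omega
    | some j =>
      obtain ⟨hj, hmin⟩ := hsome j hb
      have hch := h.change hinj hroot hj hmin
      have hs : (t.change (t.slack j)).slack j = 0 := by simp [Search.change, hj]
      simp only []
      cases hm : colMate j with
      | none =>
        simp only []
        set t' := t.change (t.slack j)
        set C := (Finset.univ.filter fun j => t.inCol j = true).card with hC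
        have hj' : t'.inCol j = false := hj
        -- In the final ranking the reached column `j` comes directly after the tree columns, and `C
        -- + 1` pushes all others beyond it. Thus the columns of rank at most that of `j` are the
        -- tree columns and `j` itself.
        have key : ∀ j', (if t.inCol j' = true then ρ j' else if j' = j then C else C + 1) ≤ C →
            j' = j ∨ t.inCol j' = true := by
          intro j' h'
          by_contra hcon
          push Not at hcon
          simp [hcon] at h'
        have hpin : ∀ j₁ j₂, colMate j₂ = some (t.pred j₁) → t.inCol j₂ = true := by
          intro j₁ j₂ h'
          rcases h.row _ (h.pred_in j₁) with h1 | ⟨j₃, h1, h2⟩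
          · exact absurd (h1 ▸ h') (hroot _)
          · rwa [hinj _ _ _ h' h2]
        refine ⟨j, fun j' => if t.inCol j' = true then ρ j' else if j' = j then C else C + 1, rfl,
          hch.feas, hch.zn, hch.free, hch.tight, hm, ?_, ?_, ?_, ?_⟩
        · simp [hj]; omega
        · intro j' h'
          rcases key j' (by simpa [hj] using h') with rfl | h1
          · have := hch.pred_slack j' hj
            linarith
          · exact hch.pred_tight j' h1
        · intro j₁ h' j₂ hm₂
          have h2 := hpin _ _ hm₂
          rcases key j₁ (by simpa [hj] using h') with rfl | h1
          · simpa [h2, hj] using h.rank_lt j₂ h2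
          · simpa [h2, h1] using h.rank_path j₁ h1 j₂ hm₂
        · intro j' h' hall
          rcases h.row _ (h.pred_in j') with h1 | ⟨j₃, h1, h2⟩
          · exact h1
          · exact absurd h2 (hall _)
      | some i =>
        simp only []
        have hg := hch.grow hinj hroot (j := j) hj hs hm
        have h3 := hg.card_eq
        have hc2 : (Finset.univ.filter fun j' =>
            ((t.change (t.slack j)).grow w j i).inCol j' = true).card =
            (Finset.univ.filter fun j => t.inCol j = true).card + 1 :=
          card_filter_update _ _ hj
        exact ih _ _ hg (by omega) h3 ((Finset.card_le_univ _).trans (by simp))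

/-- One round costs at most `4l` for the minimum, `3k ≤ 3l` and twice `3l` for the dual values and
slacks, `6l` for the enlarged tree, and `3` single steps. -/
theorem search_time_le (hkl : k ≤ l) (fuel : ℕ) (t : Search k l) :
    (search w colMate fuel t).time ≤ fuel * (19 * l + 3) := by
  induction fuel generalizing t with
  | zero => simp [search]
  | succ fuel ih =>
    unfold search
    have h1 := argmin_time_le t.slack t.inCol
    simp only [bind_time]
    cases h : (argmin t.slack t.inCol).val with
    | none =>
      simp only [pure_time]
      nlinarith
    | some j =>
      simp only [bind_time, tabulate_time, tick_time, pure_time, Finset.sum_const,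
          Finset.card_univ, Fintype.card_fin, smul_eq_mul]
      have h6 : (fuel + 1) * (19 * l + 3) = fuel * (19 * l + 3) + (19 * l + 3) := by ring
      rw [h6]
      cases h2 : colMate j with
      | none =>
        simp only [pure_time]
        omega
      | some i =>
        simp only [bind_time, tabulate_time, tick_time, pure_time, Finset.sum_const,
          Finset.card_univ, Fintype.card_fin, smul_eq_mul]
        generalize hs : (Search.mk _ _ _ _ _ _ : Search k l) = s
        have h3 := ih s
        omega

/-! ### Phases of the Hungarian method and its running time -/

/-- The invariant of the Hungarian method when the rows in `R` have been matched. -/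
structure StateInv {k l : ℕ} (w : Fin k → Fin l → ℝ) (st : State k l) (R : List (Fin k)) :
    Prop where
  feas : ∀ i j, w i j ≤ st.y i + st.z j
  yn : ∀ i, 0 ≤ st.y i
  zn : ∀ j, 0 ≤ st.z j
  free : ∀ j, st.mates.colMate j = none → st.z j = 0
  con : ∀ i j, st.mates.rowMate i = some j ↔ st.mates.colMate j = some i
  tight : ∀ i j, st.mates.rowMate i = some j → st.y i + st.z j = w i j
  matched : ∀ i, st.mates.rowMate i ≠ none ↔ i ∈ R

variable {k l : ℕ} {w : Fin k → Fin l → ℝ}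

/-- The search starts from the tree consisting of the row `i` alone, with all ranks `0`. Augmenting
along its tight path uses only edges that are tight for the new dual values and leaves matched
columns matched, so no new column becomes free. -/
theorem StateInv.phase (hkl : k ≤ l) (hw : ∀ i j, 0 ≤ w i j) {st : State k l} {R : List (Fin k)}
    (h : StateInv w st R) {i : Fin k} (hi : i ∉ R) :
    StateInv w (phase w st i).val (R ++ [i]) := by
  have hnone : st.mates.rowMate i = none := by
    by_contra hc
    exact hi ((h.matched i).1 hc)
  have hinj : ∀ i j j', st.mates.colMate j = some i → st.mates.colMate j' = some i → j = j' := by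
    intro i j j' h1 h2
    have h1 := (h.con i j).2 h1
    have h2 := (h.con i j').2 h2
    simpa [h1] using h2
  have hroot : ∀ j, st.mates.colMate j ≠ some i := by
    intro j hj
    have := (h.con i j).2 hj
    simp [hnone] at this
  set t : Search k l := { y := st.y, z := st.z, inRow := fun i' => decide (i' = i)
                          inCol := fun _ => false, slack := fun j => st.y i + st.z j - w i j
                          pred := fun _ => i } with ht
  have hcard : (Finset.univ.filter fun i' => t.inRow i' = true).card = 1 :=
    Finset.card_eq_one.2 ⟨i, by ext; simp [ht]⟩
  have hinv : SearchInv w st.mates.colMate i t (fun _ => 0) := by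
    constructor
    · exact h.feas
    · exact h.zn
    · exact h.free
    · exact fun i j hm => h.tight i j ((h.con i j).2 hm)
    · simp [ht]
    · simp [ht]
    · intro i' hr
      exact Or.inl (by simpa [ht] using hr)
    · intro j _ i' hr
      obtain rfl : i' = i := by simpa [ht] using hr
      exact le_rfl
    · simp [ht]
    · simp [ht]
    · simp [ht]
    · simp [ht]
    · simp [ht]
    · rw [hcard]; simp [ht]
  obtain ⟨j, ρ, hres, hr⟩ := search_spec hkl hinj hroot k t _ hinv (by omega)
  have hval : (Hungarian.phase w st i).val =
      { y := (search w st.mates.colMate k t).val.1.y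
        z := (search w st.mates.colMate k t).val.1.z
        mates := (augment (search w st.mates.colMate k t).val.1.pred k j st.mates).val } := by
    have hs : (search w st.mates.colMate k t).val = ((search w st.mates.colMate k t).val.1, some j) :=
      Prod.ext rfl hres
    unfold Hungarian.phase
    simp only [bind_val, pure_val, tabulate_val]
    change (match (search w st.mates.colMate k t).val.2 with
      | none => _
      | some j => _ : Timed (State k l)).val = _
    rw [hres]
    rfl
  generalize (search w st.mates.colMate k t).val.1 = t' at hr hval
  obtain ⟨h1, h2, h3, h4⟩ := augment_spec t'.pred (fun i j => t'.y i + t'.z j = w i j) i ρ k j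
    st.mates hr.rank_lt (fun j' _ i => h.con i j')
    (fun i' hm => by simpa [hr.unmatched] using (h.con i' j).1 hm)
    (fun i' j' hm => hr.tight i' j' ((h.con i' j').1 hm)) hr.pred_tight
    (fun j₁ hj₁ j₂ hm => hr.rank_path j₁ hj₁ j₂ ((h.con _ _).1 hm))
    (fun j' hj' hm => hr.root j' hj' fun j₂ hm₂ => by
      have := (h.con _ _).2 hm₂
      simp [hm] at this)
  rw [hval]
  constructor
  · exact hr.feas
  · intro i'
    -- Nonnegativity of `y` is not maintained by the search itself. It follows from the reached
    -- column, whose dual value is `0`: feasibility there gives `y i' ≥ w i' j ≥ 0`.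
    have h5 := hr.feas i' j
    have h6 := hr.free j hr.unmatched
    have h7 := hw i' j
    simp only
    linarith
  · exact hr.zn
  · intro j' hj'
    refine hr.free j' ?_
    by_contra hc
    exact h4 j' hc hj'
  · exact h1
  · exact h2
  · intro i'
    rw [h3 i', h.matched i']
    simp

theorem phase_time_le (hkl : k ≤ l) (st : State k l) (i : Fin k) :
    (phase w st i).time ≤ k * (19 * l + 3) + 5 * k + 7 * l := by
  unfold phase
  simp only [bind_time, tabulate_time, tick_time, pure_time, Finset.sum_const,
    Finset.card_univ, Fintype.card_fin, smul_eq_mul]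
  generalize hs : (Search.mk _ _ _ _ _ _ : Search k l) = s
  have h1 := search_time_le (w := w) (colMate := st.mates.colMate) hkl k s
  cases h2 : (search w st.mates.colMate k s).val.2 with
  | none =>
    simp only [pure_time]
    omega
  | some j =>
    have h3 := augment_time_le (search w st.mates.colMate k s).val.1.pred k j st.mates
    simp only [bind_time, pure_time]
    omega

theorem forEach_phase_spec (hkl : k ≤ l) (hw : ∀ i j, 0 ≤ w i j) (xs : List (Fin k))
    (R : List (Fin k)) (st : State k l) (h : StateInv w st R) (hnd : (R ++ xs).Nodup) :
    StateInv w (forEach xs st (phase w)).val (R ++ xs) := by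
  induction xs generalizing R st with
  | nil => simpa using h
  | cons x xs ih =>
    rw [forEach_cons_val]
    have hx : x ∉ R := fun hx => by
      rw [List.nodup_append] at hnd
      exact hnd.2.2 x hx x (by simp) rfl
    have := ih (R ++ [x]) _ (h.phase hkl hw hx) (by simpa using hnd)
    simpa using this

theorem le_forEach_max (f : Fin l → ℝ) (xs : List (Fin l)) (x : ℝ)
    (body : ℝ → Fin l → Timed ℝ) (hbody : ∀ x j, (body x j).val = max x (f j)) :
    x ≤ (forEach xs x body).val ∧ ∀ j ∈ xs, f j ≤ (forEach xs x body).val := by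
  induction xs generalizing x with
  | nil => simp
  | cons j xs ih =>
    rw [forEach_cons_val, hbody]
    obtain ⟨h1, h2⟩ := ih (max x (f j))
    refine ⟨(le_max_left _ _).trans h1, fun j' hj' => ?_⟩
    rcases List.mem_cons.1 hj' with rfl | h
    · exact (le_max_right _ _).trans h1
    · exact h2 j' h

/-- The Hungarian method assigns all rows, and dual values certify that the result is optimal. -/
theorem assignment_spec (hkl : k ≤ l) (hw : ∀ i j, 0 ≤ w i j) :
    ∃ st : State k l, (assignment w).val = st.mates.rowMate ∧
      StateInv w st (List.finRange k) := by
  unfold assignment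
  simp only [bind_val, pure_val, tabulate_val]
  refine ⟨_, rfl, ?_⟩
  have := forEach_phase_spec (w := w) hkl hw (List.finRange k) []
    { y := fun i => (forEach (List.finRange l) (0 : ℝ) fun x j => do
        tick 2
        pure (max x (w i j))).val
      z := fun _ => 0
      mates := { rowMate := fun _ => none, colMate := fun _ => none } } ?_ (by
        simpa using List.nodup_finRange k)
  · simpa using this
  · have hy := fun i => le_forEach_max (w i) (List.finRange l) 0 (fun x j => do
        tick 2
        pure (max x (w i j))) (fun _ _ => rfl)
    constructor
    · intro i j
      simpa using (hy i).2 j (List.mem_finRange j)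
    · exact fun i => (hy i).1
    · simp
    · simp
    · simp
    · simp
    · simp

theorem assignment_time_le (hkl : k ≤ l) :
    (assignment w).time ≤ k * (k * (19 * l + 3) + 5 * k + 7 * l + 1) + k * (3 * l + 1) + 2 * l + k := by
  unfold assignment
  have h1 : ∀ i : Fin k, (forEach (List.finRange l) (0 : ℝ) fun x j => do
        tick 2
        pure (max x (w i j))).time ≤ 3 * l := fun i =>
    (forEach_time_le_const _ _ _ 2 (by simp)).trans (by simp; omega)
  have h2 := tabulate_time_le _ _ h1
  have h3 := fun st => forEach_time_le_const (List.finRange k) st (phase w) _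
    (fun i _ st => phase_time_le hkl st i)
  simp only [bind_time, pure_time]
  generalize hs : (State.mk _ _ _ : State k l) = s
  have h4 := h3 s
  rw [List.length_finRange] at h4
  simp only [tabulate_time, pure_time, Finset.sum_const,
    Finset.card_univ, Fintype.card_fin, smul_eq_mul] at h2 ⊢
  omega

/-! ### Weak duality, and reduction of arbitrary weights to nonnegative ones -/

variable {k l : ℕ}

theorem sum_map_le_sum_univ {n : ℕ} (y : Fin n → ℝ) (hy : ∀ i, 0 ≤ y i) (xs : List (Fin n))
    (h : xs.Nodup) : (xs.map y).sum ≤ ∑ i, y i := by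
  rw [← List.sum_toFinset y h]
  exact Finset.sum_le_univ_sum_of_nonneg hy

/-- Weak duality for weighted bipartite matchings. -/
theorem sum_matching_le {w : Fin k → Fin l → ℝ} {y : Fin k → ℝ} {z : Fin l → ℝ}
    (hy : ∀ i, 0 ≤ y i) (hz : ∀ j, 0 ≤ z j) (h : ∀ i j, w i j ≤ y i + z j)
    {M : List (Fin k × Fin l)} (hM : IsMatching M) :
    (M.map fun e => w e.1 e.2).sum ≤ ∑ i, y i + ∑ j, z j := by
  have h1 := sum_map_le_sum_univ y hy _ hM.1
  have h2 := sum_map_le_sum_univ z hz _ hM.2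
  have h3 : (M.map fun e => w e.1 e.2).sum ≤ (M.map fun e => y e.1 + z e.2).sum :=
    List.sum_le_sum fun e _ => h e.1 e.2
  rw [List.sum_map_add] at h3
  simp only [List.map_map] at h1 h2
  exact h3.trans (add_le_add h1 h2)

theorem coe_list_sum {ι : Type} (f : ι → ℝ) (xs : List ι) :
    (((xs.map f).sum : ℝ) : WithBot ℝ) = (xs.map fun i => (f i : WithBot ℝ)).sum := by
  induction xs with
  | nil => rfl
  | cons x xs ih => simp [ih]

theorem le_coe_max (x : WithBot ℝ) : x ≤ ((max (x.unbotD 0) 0 : ℝ) : WithBot ℝ) := by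
  cases x with
  | bot => exact bot_le
  | coe a => exact WithBot.coe_le_coe.2 (le_max_left _ _)

theorem coe_max_of_pos {x : WithBot ℝ} (h : 0 < x) :
    ((max (x.unbotD 0) 0 : ℝ) : WithBot ℝ) = x := by
  cases x with
  | bot => exact absurd h (by simp)
  | coe a =>
    have : (0 : ℝ) < a := WithBot.coe_lt_coe.1 h
    simp [this.le]

theorem max_eq_zero_of_not_pos {x : WithBot ℝ} (h : ¬ 0 < x) : max (x.unbotD 0) 0 = (0 : ℝ) := by
  cases x with
  | bot => simp
  | coe a =>
    have : ¬ (0 : ℝ) < a := fun h' => h (WithBot.coe_lt_coe.2 h')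
    simpa using this

theorem forEach_filter_val (w : Fin k → Fin l → WithBot ℝ) (σ : Fin k → Fin l)
    (body : List (Fin k × Fin l) → Fin k → Timed (List (Fin k × Fin l)))
    (hbody : ∀ M i, (body M i).val = if 0 < w i (σ i) then (i, σ i) :: M else M)
    (xs : List (Fin k)) (M : List (Fin k × Fin l)) :
    (forEach xs M body).val =
      ((xs.filter fun i => 0 < w i (σ i)).map fun i => (i, σ i)).reverse ++ M := by
  induction xs generalizing M with
  | nil => simp
  | cons x xs ih =>
    rw [forEach_cons_val, ih, hbody]
    by_cases h : 0 < w x (σ x) <;> simp [h]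

theorem sum_filter_pos (w : Fin k → Fin l → WithBot ℝ) (σ : Fin k → Fin l) (xs : List (Fin k)) :
    ((xs.filter fun i => 0 < w i (σ i)).map fun i => w i (σ i)).sum =
      (((xs.map fun i => max ((w i (σ i)).unbotD 0) 0).sum : ℝ) : WithBot ℝ) := by
  induction xs with
  | nil => simp
  | cons x xs ih =>
    by_cases h : 0 < w x (σ x)
    · simp only [h, List.filter_cons, decide_true, if_true, List.map_cons, List.sum_cons, ih,
        WithBot.coe_add, coe_max_of_pos h]
    · simp only [h, List.filter_cons, decide_false, Bool.false_eq_true, if_false, List.map_cons,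
        List.sum_cons, ih, max_eq_zero_of_not_pos h, zero_add]

/-- Clipping at `0` can only raise the weight of a competing matching, while for the computed
assignment the clipped sum is the weight of the edges kept. By complementary slackness (all rows
matched by tight edges, `z = 0` on the remaining columns) that sum is the dual value, the bound of
weak duality. -/
theorem mwmOfLE_spec (hkl : k ≤ l) (w : Fin k → Fin l → WithBot ℝ) : IsMWM w (mwmOfLE w).val := by
  by_cases hk : k = 0
  · subst hk
    have : ∀ M : List (Fin 0 × Fin l), M = [] := fun M => by
      cases M with
      | nil => rfl
      | cons e _ => exact e.1.elim0
    have hv : (mwmOfLE w).val = [] := this _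
    rw [hv]
    exact ⟨by simp [IsMatching], fun M' _ => by rw [this M']⟩
  · obtain ⟨st, hst, h⟩ := assignment_spec (w := fun i j => max ((w i j).unbotD 0) 0) hkl
      (fun i j => le_max_right _ _)
    have hall : ∀ i, ∃ j, st.mates.rowMate i = some j := fun i =>
      Option.ne_none_iff_exists'.1 ((h.matched i).2 (List.mem_finRange i))
    choose σ hσ using hall
    have hinj : Function.Injective σ := by
      intro i i' hii
      have h1 := (h.con i (σ i)).1 (hσ i)
      have h2 := (h.con i' (σ i')).1 (hσ i')
      rw [hii, h2] at h1
      exact (Option.some.inj h1).symm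
    have hval : (mwmOfLE w).val =
        (((List.finRange k).filter fun i => 0 < w i (σ i)).map fun i => (i, σ i)).reverse := by
      unfold mwmOfLE
      simp only [hk, if_false, bind_val, tabulate_val, pure_val, hst]
      rw [forEach_filter_val w σ _ (fun M i => by simp only [bind_val, pure_val, hσ i])]
      simp
    rw [hval]
    have hdual : ∑ i, st.y i + ∑ j, st.z j =
        ((List.finRange k).map fun i => max ((w i (σ i)).unbotD 0) 0).sum := by
      rw [← Fintype.sum_of_injective σ hinj (fun i => st.z (σ i)) st.z ?_ (fun _ => rfl),
        ← Finset.sum_add_distrib, ← List.sum_toFinset _ (List.nodup_finRange k)]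
      · simp only [List.toFinset_finRange]
        exact Finset.sum_congr rfl fun i _ => h.tight i _ (hσ i)
      · intro j hj
        apply h.free
        by_contra hc
        obtain ⟨i, hi⟩ := Option.ne_none_iff_exists'.1 hc
        have := (h.con i j).2 hi
        rw [hσ i] at this
        exact hj ⟨i, Option.some.inj this⟩
    refine ⟨⟨?_, ?_⟩, fun M' hM' => ?_⟩
    · simpa [Function.comp_def, List.map_reverse] using (List.nodup_finRange k).filter _
    · have := ((List.nodup_finRange k).filter fun i => 0 < w i (σ i)).map hinj
      simpa [Function.comp_def, List.map_reverse] using this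
    · have h1 : matchingWeight w M' ≤
          (((M'.map fun e => max ((w e.1 e.2).unbotD 0) 0).sum : ℝ) : WithBot ℝ) := by
        rw [coe_list_sum]
        exact List.sum_le_sum fun e _ => le_coe_max _
      refine h1.trans ?_
      have h2 : matchingWeight w
          (((List.finRange k).filter fun i => 0 < w i (σ i)).map fun i => (i, σ i)).reverse =
          ((List.filter (fun i => decide (0 < w i (σ i))) (List.finRange k)).map
            fun i => w i (σ i)).sum := by
        rw [matchingWeight, List.map_reverse, List.sum_reverse, List.map_map]
        rfl
      rw [h2, sum_filter_pos, ← hdual]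
      exact WithBot.coe_le_coe.2 (sum_matching_le h.yn h.zn h.feas hM')

theorem length_le_of_isMatching {M : List (Fin k × Fin l)} (h : IsMatching M) : M.length ≤ k := by
  have := h.1.length_le_card
  simpa using this

theorem mwmOfLE_time_le (hkl : k ≤ l) (w : Fin k → Fin l → WithBot ℝ) :
    (mwmOfLE w).time ≤ 49 * (k * k * l) + 1 := by
  unfold mwmOfLE
  by_cases hk : k = 0
  · simp [hk]
  · have h1 : ∀ i : Fin k, (tabulate fun j => (do
        tick 1
        pure (max ((w i j).unbotD 0) 0) : Timed ℝ)).time ≤ 2 * l := fun i =>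
      (tabulate_time_le _ 1 (by simp)).trans (by omega)
    have h2 := tabulate_time_le _ _ h1
    simp only [hk, if_false, bind_time, tick_time]
    generalize (tabulate fun i => tabulate fun j => (do
        tick 1
        pure (max ((w i j).unbotD 0) 0) : Timed ℝ)) = w' at h2 ⊢
    have h3 := assignment_time_le (w := w'.val) hkl
    generalize (assignment w'.val) = r at h3 ⊢
    generalize hb : (forEach (List.finRange k) [] _ : Timed (List (Fin k × Fin l))) = f
    have h4 : f.time ≤ k * 4 := by
      rw [← hb]
      exact (forEach_time_le_const _ _ _ 3 (by simp)).trans (by simp)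
    -- From `1 ≤ k ≤ l`, each monomial is at most `k * k * l`; the coefficients `19 + 8 + 12 + 8 +
    -- 2` add up to `49`.
    have e0 : 1 ≤ k := by omega
    have e2 : k ≤ k * l := Nat.le_mul_of_pos_right _ (by omega)
    have e3 : k * l ≤ k * k * l := Nat.mul_le_mul_right _ (Nat.le_mul_of_pos_left _ e0)
    have e4 : l ≤ k * l := Nat.le_mul_of_pos_left _ e0
    have e5 : k * k ≤ k * k * l := Nat.le_mul_of_pos_right _ (by omega)
    have e6 : k * (k * (19 * l + 3) + 5 * k + 7 * l + 1) + k * (3 * l + 1) + 2 * l + k =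
      19 * (k * k * l) + 8 * (k * k) + 10 * (k * l) + 3 * k + 2 * l := by ring
    have e7 : k * (2 * l + 1) = 2 * (k * l) + k := by ring
    omega

theorem isMatching_swap {M : List (Fin k × Fin l)} (h : IsMatching M) :
    IsMatching (M.map Prod.swap) := by
  refine ⟨?_, ?_⟩
  · simpa [Function.comp_def] using h.2
  · simpa [Function.comp_def] using h.1

theorem matchingWeight_swap (w : Fin k → Fin l → WithBot ℝ) (M : List (Fin k × Fin l)) :
    matchingWeight (fun j i => w i j) (M.map Prod.swap) = matchingWeight w M := by
  simp [matchingWeight, Function.comp_def]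

theorem mwm_spec (k l : ℕ) (w : Fin k → Fin l → WithBot ℝ) : IsMWM w (mwm k l w).val := by
  unfold mwm
  by_cases hkl : k ≤ l
  · simp only [hkl, if_true, bind_val]
    exact mwmOfLE_spec hkl w
  · simp only [hkl, if_false, bind_val, pure_val, tabulate_val]
    obtain ⟨h1, h2⟩ := mwmOfLE_spec (Nat.le_of_not_le hkl) fun j i => w i j
    refine ⟨isMatching_swap h1, fun M' hM' => ?_⟩
    rw [matchingWeight_swap (fun j i => w i j), ← matchingWeight_swap w M']
    exact h2 _ (isMatching_swap hM')

/-- Exchanging the sides costs `2kl + l` steps for the transposed weights and at most `l` for the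
matching, which raises `49` to `53`. -/
theorem mwm_time_le (k l : ℕ) (w : Fin k → Fin l → WithBot ℝ) :
    (mwm k l w).time ≤ 53 * (k * l * min k l + 1) := by
  unfold mwm
  by_cases hkl : k ≤ l
  · have := mwmOfLE_time_le hkl w
    simp only [hkl, if_true, bind_time, tick_time, min_eq_left]
    have e : k * l * k = k * k * l := by ring
    omega
  · have hlk := Nat.le_of_not_le hkl
    simp only [hkl, if_false, bind_time, tick_time, hlk, min_eq_right, pure_time]
    have h1 : ∀ j : Fin l, (tabulate fun i : Fin k => (do
        tick 1
        pure (w i j) : Timed (WithBot ℝ))).time ≤ 2 * k := fun i =>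
      (tabulate_time_le _ 1 (by simp)).trans (by omega)
    have h2 := tabulate_time_le _ _ h1
    generalize (tabulate fun j : Fin l => tabulate fun i : Fin k => (do
        tick 1
        pure (w i j) : Timed (WithBot ℝ))) = w' at h2 ⊢
    have h3 := mwmOfLE_time_le hlk w'.val
    have h4 := length_le_of_isMatching (mwmOfLE_spec hlk w'.val).1
    have e1 : k * l * l = l * l * k := by ring
    have e2 : l * (2 * k + 1) = 2 * (l * k) + l := by ring
    have e3 : l * k ≤ l * l * k := by
      rcases Nat.eq_zero_or_pos l with h | h
      · simp [h]
      · exact Nat.mul_le_mul_right _ (Nat.le_mul_of_pos_left _ h)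
    have e4 : l ≤ l * k := by
      exact Nat.le_mul_of_pos_right _ (by omega)
    omega

theorem computesMWM_mwm : ComputesMWM mwm 53 := by
  refine ⟨mwm_spec, fun k l w => ?_⟩
  have h : ((mwm k l w).time : ℝ) ≤ 53 * ((k : ℝ) * l * min (k : ℝ) l + 1) := by
    exact_mod_cast mwm_time_le k l w
  refine h.trans ?_
  -- The Hungarian bound has no logarithm. The term may be added because the logarithm of a natural
  -- number is nonnegative, also at `0` by the convention `log 0 = 0`.
  have h1 : 0 ≤ (k : ℝ) * l * Real.log (max (k : ℝ) l) := by
    refine mul_nonneg (by positivity) ?_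
    rw [← Nat.cast_max]
    exact Real.log_natCast_nonneg _
  have h2 := mul_add ((k : ℝ) * l) (min (k : ℝ) l) (Real.log (max (k : ℝ) l))
  linarith

end Hungarian

/-! ### Branches of trees -/

/-- The vertices of the subtree with root `v` of a tree that is rooted at `s`, where `s` is equal
or adjacent to `v`. -/
def branch {V : Type} (G : SimpleGraph V) (s v : V) : Set V := {x | G.dist v x ≤ G.dist s x}

section Branch

variable {V : Type} {G : SimpleGraph V}

theorem mem_branch {s v x : V} : x ∈ branch G s v ↔ G.dist v x ≤ G.dist s x := Iff.rfl

theorem mem_branch_self (v x : V) : x ∈ branch G v v := le_refl (G.dist v x)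

theorem root_mem_branch (s v : V) : v ∈ branch G s v := by simp [mem_branch]

theorem not_mem_branch (hG : G.IsTree) {s v : V} (h : G.Adj s v) : s ∉ branch G s v := by
  simp only [mem_branch, SimpleGraph.dist_self, not_le]
  exact hG.connected.pos_dist_of_ne h.ne'

theorem dist_eq_of_mem_branch (hG : G.IsTree) {s v x : V} (h : G.Adj s v)
    (hx : x ∈ branch G s v) : G.dist s x = G.dist v x + 1 := by
  have := hG.dist_eq_dist_add_one_of_adj x h
  rw [mem_branch] at hx
  simp only [G.dist_comm (u := x)] at this
  omega

theorem dist_eq_of_not_mem_branch (hG : G.IsTree) {s v x : V} (h : G.Adj s v)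
    (hx : x ∉ branch G s v) : G.dist v x = G.dist s x + 1 := by
  have := hG.dist_eq_dist_add_one_of_adj x h
  rw [mem_branch] at hx
  simp only [G.dist_comm (u := x)] at this
  omega

/-- Shortest walks to `x` through `a` and through `b` are both paths from `v` to `x`. Paths in a
tree are unique, so their second vertices agree. -/
theorem closer_unique (hG : G.IsTree) {v a b x : V} (ha : G.Adj v a) (hb : G.Adj v b)
    (h1 : G.dist a x < G.dist v x) (h2 : G.dist b x < G.dist v x) : a = b := by
  obtain ⟨p, hp⟩ := hG.connected.exists_walk_length_eq_dist a x
  obtain ⟨q, hq⟩ := hG.connected.exists_walk_length_eq_dist b x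
  have hp' := SimpleGraph.dist_le (p.cons ha)
  have hq' := SimpleGraph.dist_le (q.cons hb)
  simp only [SimpleGraph.Walk.length_cons] at hp' hq'
  have hpp := (p.cons ha).isPath_of_length_eq_dist (by simp; omega)
  have hqp := (q.cons hb).isPath_of_length_eq_dist (by simp; omega)
  have := (hG.existsUnique_path v x).unique hpp hqp
  injection this

theorem exists_closer (hG : G.IsTree) {v x : V} (h : v ≠ x) :
    ∃ a, G.Adj v a ∧ G.dist a x < G.dist v x := by
  obtain ⟨p, hp⟩ := hG.connected.exists_walk_length_eq_dist v x
  cases p with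
  | nil => exact absurd rfl h
  | cons ha q =>
    refine ⟨_, ha, ?_⟩
    have := SimpleGraph.dist_le q
    simp only [SimpleGraph.Walk.length_cons] at hp
    omega

theorem branch_unique (hG : G.IsTree) {v a b x : V} (ha : G.Adj v a) (hb : G.Adj v b)
    (h1 : x ∈ branch G v a) (h2 : x ∈ branch G v b) : a = b := by
  have h1 := dist_eq_of_mem_branch hG ha h1
  have h2 := dist_eq_of_mem_branch hG hb h2
  exact closer_unique (x := x) hG ha hb (by omega) (by omega)

theorem exists_branch (hG : G.IsTree) {v x : V} (h : x ≠ v) :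
    ∃ a, G.Adj v a ∧ x ∈ branch G v a := by
  obtain ⟨a, ha, h⟩ := exists_closer hG h.symm
  exact ⟨a, ha, h.le⟩

theorem branch_subset (hG : G.IsTree) {s v a : V} (hs : s = v ∨ G.Adj s v) (ha : G.Adj v a)
    (hne : a ≠ s) : branch G v a ⊆ branch G s v := by
  intro x hx
  rcases hs with rfl | hs
  · exact mem_branch_self _ _
  · by_contra hc
    have h1 := dist_eq_of_not_mem_branch hG hs hc
    have h2 := dist_eq_of_mem_branch hG ha hx
    exact hne (closer_unique (x := x) hG ha hs.symm (by omega) (by omega))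

/-- The root edge is the only edge leaving a branch; this is where acyclicity enters most of the
arguments below. -/
theorem branch_crossing (hG : G.IsTree) {s v x y : V} (hs : G.Adj s v) (hx : x ∈ branch G s v)
    (hy : y ∉ branch G s v) (hxy : G.Adj x y) : x = v ∧ y = s := by
  have h1 := dist_eq_of_mem_branch hG hs hx
  have h2 := dist_eq_of_not_mem_branch hG hs hy
  have h3 := hG.dist_eq_dist_add_one_of_adj v hxy
  have h4 := hG.dist_eq_dist_add_one_of_adj s hxy
  by_cases h : y = s
  · subst h
    rw [SimpleGraph.dist_self] at h2 h4
    have h5 : G.dist v x = 0 := by omega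
    exact ⟨(hG.connected.dist_eq_zero_iff.1 h5).symm, rfl⟩
  · obtain ⟨z, hz, hzs⟩ := exists_closer hG h
    have h5 := hG.dist_eq_dist_add_one_of_adj z hs
    simp only [G.dist_comm (v := s), G.dist_comm (v := v)] at *
    have h6 : z = x := by
      refine closer_unique hG (x := v) hz hxy.symm ?_ ?_
      · simp only [G.dist_comm (v := v)]; omega
      · simp only [G.dist_comm (v := v)]; omega
    subst h6
    omega

end Branch

/-! ### Embeddings of rooted subtrees -/

/-- `f` embeds the subtree of `G` with vertex set `S` into `H`, maps its root `u` to `v`, and stays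
inside the branches with roots `u` and `v`. -/
structure IsEmb {V W : Type} (G : SimpleGraph V) (H : SimpleGraph W) (p u : V) (s v : W)
    (S : Finset V) (f : V → W) : Prop where
  mem : u ∈ S
  map_root : f u = v
  sub : ∀ x ∈ S, x ∈ branch G p u
  maps : ∀ x ∈ S, f x ∈ branch H s v
  inj : ∀ x ∈ S, ∀ y ∈ S, f x = f y → x = y
  adj : ∀ x ∈ S, ∀ y ∈ S, G.Adj x y → H.Adj (f x) (f y)
  conn : ∀ x ∈ S, x ≠ u → ∃ y ∈ S, G.Adj x y ∧ G.dist u y < G.dist u x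

open Classical in
/-- The edges of `G` inside `S`. -/
def edgesIn {V : Type} [Fintype V] (G : SimpleGraph V) (S : Finset V) : Finset (Sym2 V) :=
  G.edgeFinset.filter fun e => ∀ x ∈ e, x ∈ S

/-- The weight of an embedding of the subtree with vertex set `S`. -/
def embWeight {V W : Type} [Fintype V] (G : SimpleGraph V) (wV : V → W → WithBot ℝ)
    (wE : Sym2 V → Sym2 W → WithBot ℝ) (S : Finset V) (f : V → W) : WithBot ℝ :=
  ∑ x ∈ S, wV x (f x) + ∑ e ∈ edgesIn G S, wE e (e.map f)

section Emb

variable {V W : Type} {G : SimpleGraph V} {H : SimpleGraph W}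

theorem mem_edgesIn [Fintype V] {S : Finset V} {x y : V} :
    s(x, y) ∈ edgesIn G S ↔ G.Adj x y ∧ x ∈ S ∧ y ∈ S := by
  simp [edgesIn]

theorem embWeight_congr [Fintype V] (wV : V → W → WithBot ℝ) (wE : Sym2 V → Sym2 W → WithBot ℝ)
    {S : Finset V} {f g : V → W} (h : ∀ x ∈ S, f x = g x) :
    embWeight G wV wE S f = embWeight G wV wE S g := by
  unfold embWeight
  congr 1
  · exact Finset.sum_congr rfl fun x hx => by rw [h x hx]
  · refine Finset.sum_congr rfl fun e he => ?_
    induction e with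
    | _ x y =>
      rw [mem_edgesIn] at he
      simp [h x he.2.1, h y he.2.2]

/-- Descending towards `u` inside `S` cannot leave the branch before reaching `u`, by
`branch_crossing`. -/
theorem mem_child_branch (hG : G.IsTree) {u : V} {S : Finset V}
    (hS : ∀ x ∈ S, x ≠ u → ∃ y ∈ S, G.Adj x y ∧ G.dist u y < G.dist u x) :
    ∀ x ∈ S, x ≠ u → ∃ a ∈ S, G.Adj u a ∧ x ∈ branch G u a := by
  intro x
  induction hn : G.dist u x using Nat.strong_induction_on generalizing x with
  | _ n ih =>
    intro hx hxu
    obtain ⟨y, hy, hxy, hlt⟩ := hS x hx hxu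
    by_cases hyu : y = u
    · subst hyu
      exact ⟨x, hx, hxy.symm, root_mem_branch _ _⟩
    · obtain ⟨a, ha, hua, hya⟩ := ih _ (hn ▸ hlt) y rfl hy hyu
      refine ⟨a, ha, hua, ?_⟩
      by_contra hc
      exact hxu (branch_crossing hG hua hya hc hxy.symm).2

open Classical in
-- Away from `u`, the set `S` is the disjoint union of its pieces in the branches at the neighbours
-- of `u` in `S`. An edge inside `S` either joins `u` to such a neighbour or stays in one piece.
theorem embWeight_decomp [Fintype V] (hG : G.IsTree) (wV : V → W → WithBot ℝ)
    (wE : Sym2 V → Sym2 W → WithBot ℝ) {u : V} {S : Finset V} (f : V → W) (hu : u ∈ S)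
    (hS : ∀ x ∈ S, x ≠ u → ∃ y ∈ S, G.Adj x y ∧ G.dist u y < G.dist u x) :
    embWeight G wV wE S f = wV u (f u) + ∑ a ∈ S.filter (G.Adj u),
      (wE s(u, a) s(f u, f a) + embWeight G wV wE (S.filter (· ∈ branch G u a)) f) := by
  have hV : S = insert u ((S.filter (G.Adj u)).biUnion fun a => S.filter (· ∈ branch G u a)) := by
    ext x
    simp only [Finset.mem_insert, Finset.mem_biUnion, Finset.mem_filter]
    constructor
    · intro hx
      by_cases hxu : x = u
      · exact Or.inl hxu
      · obtain ⟨a, ha, hua, hxa⟩ := mem_child_branch hG hS x hx hxu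
        exact Or.inr ⟨a, ⟨ha, hua⟩, hx, hxa⟩
    · rintro (rfl | ⟨a, _, hx, _⟩)
      · exact hu
      · exact hx
  have hE : edgesIn G S = (S.filter (G.Adj u)).biUnion fun a =>
      insert s(u, a) (edgesIn G (S.filter (· ∈ branch G u a))) := by
    ext e
    induction e with
    | _ x y =>
      simp only [Finset.mem_insert, Finset.mem_biUnion, Finset.mem_filter, mem_edgesIn]
      constructor
      · rintro ⟨hxy, hx, hy⟩
        by_cases hxu : x = u
        · subst hxu
          exact ⟨y, ⟨hy, hxy⟩, Or.inl rfl⟩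
        · obtain ⟨a, ha, hua, hxa⟩ := mem_child_branch hG hS x hx hxu
          refine ⟨a, ⟨ha, hua⟩, ?_⟩
          by_cases hya : y ∈ branch G u a
          · exact Or.inr ⟨hxy, ⟨hx, hxa⟩, hy, hya⟩
          · obtain ⟨rfl, rfl⟩ := branch_crossing hG hua hxa hya hxy
            exact Or.inl Sym2.eq_swap
      · rintro ⟨a, ⟨ha, hua⟩, h | h⟩
        · rw [Sym2.eq_iff] at h
          rcases h with ⟨rfl, rfl⟩ | ⟨rfl, rfl⟩
          · exact ⟨hua, hu, ha⟩
          · exact ⟨hua.symm, ha, hu⟩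
        · exact ⟨h.1, h.2.1.1, h.2.2.1⟩
  have hdisj : ∀ a ∈ S.filter (G.Adj u), ∀ b ∈ S.filter (G.Adj u), ∀ x, x ∈ branch G u a →
      x ∈ branch G u b → a = b := by
    intro a ha b hb x h1 h2
    exact branch_unique hG (Finset.mem_filter.1 ha).2 (Finset.mem_filter.1 hb).2 h1 h2
  have h1 : ∑ x ∈ S, wV x (f x) = wV u (f u) +
      ∑ a ∈ S.filter (G.Adj u), ∑ x ∈ S.filter (· ∈ branch G u a), wV x (f x) := by
    conv_lhs => rw [hV]
    rw [Finset.sum_insert, Finset.sum_biUnion]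
    · intro a ha b hb hab
      rw [Function.onFun, Finset.disjoint_left]
      intro x hx hx'
      exact hab (hdisj a ha b hb x (Finset.mem_filter.1 hx).2 (Finset.mem_filter.1 hx').2)
    · simp only [Finset.mem_biUnion, Finset.mem_filter, not_exists, not_and]
      rintro a ⟨_, hua⟩ _
      exact not_mem_branch hG hua
  have hnot : ∀ a ∈ S.filter (G.Adj u), ∀ x, s(u, x) ∉ edgesIn G (S.filter (· ∈ branch G u a)) := by
    intro a ha x h
    rw [mem_edgesIn] at h
    exact not_mem_branch hG (Finset.mem_filter.1 ha).2 (Finset.mem_filter.1 h.2.1).2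
  have h2 : ∑ e ∈ edgesIn G S, wE e (e.map f) =
      ∑ a ∈ S.filter (G.Adj u), (wE s(u, a) s(f u, f a) +
        ∑ e ∈ edgesIn G (S.filter (· ∈ branch G u a)), wE e (e.map f)) := by
    rw [hE, Finset.sum_biUnion]
    · refine Finset.sum_congr rfl fun a ha => ?_
      rw [Finset.sum_insert (hnot a ha a)]
      simp
    · intro a ha b hb hab
      rw [Function.onFun, Finset.disjoint_left]
      intro e he he'
      rcases Finset.mem_insert.1 he with rfl | he
      · rcases Finset.mem_insert.1 he' with h | he'
        · exact hab (Sym2.congr_right.1 h)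
        · exact hnot b hb a he'
      · rcases Finset.mem_insert.1 he' with rfl | he'
        · exact hnot a ha b he
        · induction e with
          | _ x y =>
            rw [mem_edgesIn] at he he'
            exact hab (hdisj a ha b hb x (Finset.mem_filter.1 he.2.1).2
              (Finset.mem_filter.1 he'.2.1).2)
  unfold embWeight
  rw [h1, h2, add_assoc, ← Finset.sum_add_distrib]
  congr 1
  refine Finset.sum_congr rfl fun a _ => ?_
  rw [← add_assoc, ← add_assoc, add_comm (∑ x ∈ _, _)]

open Classical in
-- The image can leave the branch at `f a` only through `v`. By injectivity `u` alone is sent to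
-- `v`, and `u` is not in the branch at `a`.
theorem IsEmb.restrict (hG : G.IsTree) (hH : H.IsTree) {p u : V} {s v : W} {S : Finset V}
    {f : V → W} (h : IsEmb G H p u s v S f) {a : V} (ha : a ∈ S) (hua : G.Adj u a) :
    IsEmb G H u a v (f a) (S.filter (· ∈ branch G u a)) f := by
  have hconn : ∀ x ∈ S.filter (· ∈ branch G u a), x ≠ a →
      ∃ y ∈ S.filter (· ∈ branch G u a), G.Adj x y ∧ G.dist a y < G.dist a x := by
    intro x hx hxa
    rw [Finset.mem_filter] at hx
    have hxu : x ≠ u := by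
      rintro rfl
      exact not_mem_branch hG hua hx.2
    obtain ⟨y, hy, hxy, hlt⟩ := h.conn x hx.1 hxu
    have hyb : y ∈ branch G u a := by
      by_contra hc
      exact hxa (branch_crossing hG hua hx.2 hc hxy).1
    refine ⟨y, Finset.mem_filter.2 ⟨hy, hyb⟩, hxy, ?_⟩
    have h1 := dist_eq_of_mem_branch hG hua hyb
    have h2 := dist_eq_of_mem_branch hG hua hx.2
    omega
  refine ⟨Finset.mem_filter.2 ⟨ha, root_mem_branch _ _⟩, rfl, fun x hx => (Finset.mem_filter.1 hx).2,
    ?_, fun x hx y hy => h.inj x (Finset.mem_filter.1 hx).1 y (Finset.mem_filter.1 hy).1,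
    fun x hx y hy => h.adj x (Finset.mem_filter.1 hx).1 y (Finset.mem_filter.1 hy).1, hconn⟩
  have hadj : H.Adj v (f a) := h.map_root ▸ h.adj u h.mem a ha hua
  intro x
  induction hn : G.dist a x using Nat.strong_induction_on generalizing x with
  | _ n ih =>
    intro hx
    by_cases hxa : x = a
    · subst hxa
      exact root_mem_branch _ _
    · obtain ⟨y, hy, hxy, hlt⟩ := hconn x hx hxa
      have h1 := ih _ (hn ▸ hlt) y rfl hy
      have hx' := Finset.mem_filter.1 hx
      by_contra hc
      have h2 := branch_crossing hH hadj h1 hc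
        (h.adj x hx'.1 y (Finset.mem_filter.1 hy).1 hxy).symm
      have h3 := h.inj x hx'.1 u h.mem (h2.2.trans h.map_root.symm)
      subst h3
      exact not_mem_branch hG hua hx'.2

theorem IsEmb.child_ne (hG : G.IsTree) {p u : V} {s v : W} {S : Finset V}
    {f : V → W} (h : IsEmb G H p u s v S f) {a : V} (ha : a ∈ S) (hua : G.Adj u a) : a ≠ p := by
  rintro rfl
  exact not_mem_branch hG hua.symm (h.sub a ha)

theorem IsEmb.map_child_ne (hH : H.IsTree) {p u : V} {s v : W} {S : Finset V}
    {f : V → W} (h : IsEmb G H p u s v S f) {a : V} (ha : a ∈ S) (hua : G.Adj u a) : f a ≠ s := by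
  rintro rfl
  have := h.adj u h.mem a ha hua
  rw [h.map_root] at this
  exact not_mem_branch hH this.symm (h.maps a ha)

open Classical in
/-- Embeddings of branches at distinct children of `u` into branches at distinct children of `v`
together form an embedding. -/
theorem exists_glued_isEmb [Fintype V] (hG : G.IsTree) (hH : H.IsTree) (wV : V → W → WithBot ℝ)
    (wE : Sym2 V → Sym2 W → WithBot ℝ) {p u : V} {s v : W} (hp : p = u ∨ G.Adj p u)
    (hs : s = v ∨ H.Adj s v) (U : Finset V) (g : V → W) (T : V → Finset V) (F : V → V → W)
    (hU : ∀ a ∈ U, G.Adj u a ∧ a ≠ p) (hg : ∀ a ∈ U, H.Adj v (g a) ∧ g a ≠ s)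
    (hinj : ∀ a ∈ U, ∀ b ∈ U, g a = g b → a = b)
    (hemb : ∀ a ∈ U, IsEmb G H u a v (g a) (T a) (F a)) :
    ∃ S f, IsEmb G H p u s v S f ∧ embWeight G wV wE S f = wV u v +
      ∑ a ∈ U, (wE s(u, a) s(v, g a) + embWeight G wV wE (T a) (F a)) := by
  -- The child `c x` of `u` above `x` selects which of the embeddings to apply at `x`. Outside all
  -- these branches the value is irrelevant.
  have hc : ∀ x, ∃ c, ∀ a, G.Adj u a → x ∈ branch G u a → c = a := by
    intro x
    by_cases h : ∃ a, G.Adj u a ∧ x ∈ branch G u a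
    · obtain ⟨a, h1, h2⟩ := h
      exact ⟨a, fun b h3 h4 => branch_unique hG h1 h3 h2 h4⟩
    · exact ⟨x, fun a h1 h2 => absurd ⟨a, h1, h2⟩ h⟩
  choose c hc using hc
  have hcT : ∀ a ∈ U, ∀ x ∈ T a, c x = a := fun a ha x hx =>
    hc x a (hU a ha).1 ((hemb a ha).sub x hx)
  have huT : ∀ a ∈ U, ∀ x ∈ T a, x ≠ u := by
    rintro a ha x hx rfl
    exact not_mem_branch hG (hU a ha).1 ((hemb a ha).sub x hx)
  set S : Finset V := insert u (U.biUnion T) with hS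
  set f : V → W := fun x => if x = u then v else F (c x) x with hf
  have hfu : f u = v := by simp [hf]
  have hfT : ∀ a ∈ U, ∀ x ∈ T a, f x = F a x := fun a ha x hx => by
    simp [hf, huT a ha x hx, hcT a ha x hx]
  have hfb : ∀ a ∈ U, ∀ x ∈ T a, f x ∈ branch H v (g a) := fun a ha x hx =>
    hfT a ha x hx ▸ (hemb a ha).maps x hx
  have hfv : ∀ a ∈ U, ∀ x ∈ T a, f x ≠ v := by
    intro a ha x hx h
    exact not_mem_branch hH (hg a ha).1 (h ▸ hfb a ha x hx)
  have hmem : ∀ x ∈ S, x = u ∨ ∃ a ∈ U, x ∈ T a := by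
    intro x hx
    simpa [hS] using hx
  have hTS : ∀ a ∈ U, ∀ x ∈ T a, x ∈ S := by
    intro a ha x hx
    simp only [hS, Finset.mem_insert, Finset.mem_biUnion]
    exact Or.inr ⟨a, ha, hx⟩
  have huS : u ∈ S := Finset.mem_insert_self _ _
  have hadju : ∀ b ∈ U, ∀ y ∈ T b, G.Adj u y → y = b := by
    intro b hb y hy huy
    exact branch_unique hG huy (hU b hb).1 (root_mem_branch _ _) ((hemb b hb).sub y hy)
  have hconn : ∀ x ∈ S, x ≠ u → ∃ y ∈ S, G.Adj x y ∧ G.dist u y < G.dist u x := by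
    intro x hx hxu
    rcases hmem x hx with h | ⟨a, ha, hxa⟩
    · exact absurd h hxu
    · by_cases hxa' : x = a
      · subst hxa'
        refine ⟨u, huS, (hU x ha).1.symm, ?_⟩
        simpa using hG.connected.pos_dist_of_ne hxu.symm
      · obtain ⟨y, hy, hxy, hlt⟩ := (hemb a ha).conn x hxa hxa'
        refine ⟨y, hTS a ha y hy, hxy, ?_⟩
        have h1 := dist_eq_of_mem_branch hG (hU a ha).1 ((hemb a ha).sub x hxa)
        have h2 := dist_eq_of_mem_branch hG (hU a ha).1 ((hemb a ha).sub y hy)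
        omega
  refine ⟨S, f, ⟨huS, hfu, ?_, ?_, ?_, ?_, hconn⟩, ?_⟩
  · intro x hx
    rcases hmem x hx with rfl | ⟨a, ha, hxa⟩
    · exact root_mem_branch _ _
    · exact branch_subset hG hp (hU a ha).1 (hU a ha).2 ((hemb a ha).sub x hxa)
  · intro x hx
    rcases hmem x hx with rfl | ⟨a, ha, hxa⟩
    · rw [hfu]; exact root_mem_branch _ _
    · exact branch_subset hH hs (hg a ha).1 (hg a ha).2 (hfb a ha x hxa)
  · intro x hx y hy hxy
    rcases hmem x hx with rfl | ⟨a, ha, hxa⟩ <;> rcases hmem y hy with rfl | ⟨b, hb, hyb⟩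
    · rfl
    · exact absurd (hxy.symm.trans hfu) (hfv b hb y hyb)
    · exact absurd (hxy.trans hfu) (hfv a ha x hxa)
    · have h1 := branch_unique hH (hg a ha).1 (hg b hb).1 (hfb a ha x hxa) (hxy ▸ hfb b hb y hyb)
      obtain rfl := hinj a ha b hb h1
      exact (hemb a ha).inj x hxa y hyb (by rwa [← hfT a ha x hxa, ← hfT a ha y hyb])
  · intro x hx y hy hxy
    rcases hmem x hx with rfl | ⟨a, ha, hxa⟩ <;> rcases hmem y hy with rfl | ⟨b, hb, hyb⟩
    · exact absurd hxy G.irrefl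
    · obtain rfl := hadju b hb y hyb hxy
      rw [hfu, hfT y hb y hyb, (hemb y hb).map_root]
      exact (hg y hb).1
    · obtain rfl := hadju a ha x hxa hxy.symm
      rw [hfu, hfT x ha x hxa, (hemb x ha).map_root]
      exact (hg x ha).1.symm
    · have hya : y ∈ branch G u a := by
        by_contra hcon
        exact huT b hb y hyb (branch_crossing hG (hU a ha).1 ((hemb a ha).sub x hxa) hcon hxy).2
      obtain rfl := branch_unique hG (hU a ha).1 (hU b hb).1 hya ((hemb b hb).sub y hyb)
      rw [hfT a ha x hxa, hfT a ha y hyb]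
      exact (hemb a ha).adj x hxa y hyb hxy
  · rw [embWeight_decomp hG wV wE f huS hconn, hfu]
    congr 1
    have hUS : S.filter (G.Adj u) = U := by
      ext x
      rw [Finset.mem_filter]
      constructor
      · rintro ⟨hx, hux⟩
        rcases hmem x hx with rfl | ⟨a, ha, hxa⟩
        · exact absurd hux G.irrefl
        · rwa [hadju a ha x hxa hux]
      · intro hx
        exact ⟨hTS x hx x (hemb x hx).mem, (hU x hx).1⟩
    rw [hUS]
    refine Finset.sum_congr rfl fun a ha => ?_
    have hTa : S.filter (· ∈ branch G u a) = T a := by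
      ext x
      rw [Finset.mem_filter]
      constructor
      · rintro ⟨hx, hxa⟩
        rcases hmem x hx with rfl | ⟨b, hb, hxb⟩
        · exact absurd hxa (not_mem_branch hG (hU a ha).1)
        · rwa [branch_unique hG (hU a ha).1 (hU b hb).1 hxa ((hemb b hb).sub x hxb)]
      · intro hx
        exact ⟨hTS a ha x hx, (hemb a ha).sub x hx⟩
    rw [hTa, embWeight_congr wV wE (hfT a ha), hfT a ha a (hemb a ha).mem, (hemb a ha).map_root]

end Emb

/-! ### Common subtree isomorphisms and embeddings -/

section

variable {V W : Type} {G : SimpleGraph V} {H : SimpleGraph W}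

/-- An injective homomorphism from a subtree to a tree reflects adjacency. -/
theorem adj_of_map_adj (hH : H.IsTree) {S : Set V} (hS : (G.induce S).Connected) {f : V → W}
    (hinj : Set.InjOn f S) (hadj : ∀ x ∈ S, ∀ y ∈ S, G.Adj x y → H.Adj (f x) (f y))
    {x y : V} (hx : x ∈ S) (hy : y ∈ S) (h : H.Adj (f x) (f y)) : G.Adj x y := by
  let F : G.induce S →g H := ⟨fun z => f z, fun {a b} hab => hadj a a.2 b b.2 hab⟩
  have hF : Function.Injective F := fun a b hab => Subtype.ext (hinj a.2 b.2 hab)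
  obtain ⟨q, hq⟩ := (hS.exists_path_of_dist ⟨x, hx⟩ ⟨y, hy⟩)
  have h1 : (q.map F).IsPath := hq.1.map hF
  have h2 : (SimpleGraph.Walk.cons h SimpleGraph.Walk.nil).IsPath := by
    simp [h.ne]
  have h3 := (hH.existsUnique_path _ _).unique h1 h2
  have h4 : q.length = 1 := by
    have := congrArg SimpleGraph.Walk.length h3
    simpa using this
  have h5 : (G.induce S).Adj ⟨x, hx⟩ ⟨y, hy⟩ := SimpleGraph.Walk.adj_of_length_eq_one h4
  exact h5

theorem IsEmb.connected {p u : V} {s v : W} {S : Finset V} {f : V → W}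
    (h : IsEmb G H p u s v S f) : (G.induce (S : Set V)).Connected := by
  have key : ∀ x (hx : x ∈ S), (G.induce (S : Set V)).Reachable ⟨x, hx⟩ ⟨u, h.mem⟩ := by
    intro x
    induction hn : G.dist u x using Nat.strong_induction_on generalizing x with
    | _ n ih =>
      intro hx
      by_cases hxu : x = u
      · subst hxu
        exact SimpleGraph.Reachable.refl _
      · obtain ⟨y, hy, hxy, hlt⟩ := h.conn x hx hxu
        have h1 := ih _ (hn ▸ hlt) y rfl hy
        have h2 : (G.induce (S : Set V)).Adj ⟨x, hx⟩ ⟨y, hy⟩ := hxy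
        exact h2.reachable.trans h1
  have : Nonempty (S : Set V) := ⟨⟨u, h.mem⟩⟩
  exact ⟨fun a b => (key a a.2).trans (key b b.2).symm⟩

theorem CommonSubtreeIso.weight_eq_embWeight [Fintype V] (φ : CommonSubtreeIso G H)
    (wV : V → W → WithBot ℝ) (wE : Sym2 V → Sym2 W → WithBot ℝ) (S : Finset V)
    (hS : ∀ x, x ∈ S ↔ x ∈ φ.dom) (f : V → W) (hf : ∀ x : φ.dom, f x = φ.iso x) :
    φ.weight wV wE = embWeight G wV wE S f := by
  classical
  unfold CommonSubtreeIso.weight embWeight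
  congr 1
  · rw [Finset.sum_subtype S hS fun x => wV x (f x)]
    exact Finset.sum_congr rfl fun x _ => by rw [hf]
  · refine Finset.sum_bij (fun e _ => e.map Subtype.val) ?_ ?_ ?_ ?_
    · intro e he
      induction e with
      | _ x y =>
        simp only [Sym2.map_mk, mem_edgesIn]
        have he : (G.induce φ.dom).Adj x y := by simpa using he
        exact ⟨he, (hS _).2 x.2, (hS _).2 y.2⟩
    · intro e _ e' _ h
      exact Sym2.map.injective Subtype.val_injective h
    · intro e he
      induction e with
      | _ x y =>
        rw [mem_edgesIn] at he
        refine ⟨s(⟨x, (hS _).1 he.2.1⟩, ⟨y, (hS _).1 he.2.2⟩), ?_, rfl⟩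
        simpa using he.1
    · intro e _
      rw [Sym2.map_map]
      congr 2
      funext x
      exact (hf x).symm

theorem IsEmb.exists_iso [Fintype V] (hG : G.IsTree) (hH : H.IsTree)
    (wV : V → W → WithBot ℝ) (wE : Sym2 V → Sym2 W → WithBot ℝ) {p u : V} {s v : W} {S : Finset V}
    {f : V → W} (h : IsEmb G H p u s v S f) :
    ∃ φ : CommonSubtreeIso G H, φ.weight wV wE = embWeight G wV wE S f := by
  have hinj : Set.InjOn f (S : Set V) := fun x hx y hy => h.inj x hx y hy
  let φ : CommonSubtreeIso G H :=
    { dom := S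
      cod := f '' S
      iso := ⟨Equiv.Set.imageOfInjOn f S hinj, by
        intro a b
        exact ⟨fun hab => adj_of_map_adj hH h.connected hinj h.adj a.2 b.2 hab,
          fun hab => h.adj a a.2 b b.2 hab⟩⟩
      isTree := ⟨h.connected, hG.isAcyclic.induce _⟩ }
  exact ⟨φ, φ.weight_eq_embWeight wV wE S (fun x => Iff.rfl) f fun x => rfl⟩

/-- Take for `u` the vertex of the domain nearest to `r`. Its parent is nearer still, hence not in
the domain, and a connected set containing `u` but not the parent stays in the branch at `u`. With
`s = v` the branch in `H` is all of `H`, so nothing is required of the image. -/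
theorem CommonSubtreeIso.exists_isEmb [Fintype V] (hG : G.IsTree)
    (wV : V → W → WithBot ℝ) (wE : Sym2 V → Sym2 W → WithBot ℝ) (φ : CommonSubtreeIso G H)
    (par : V → V) (r : V) (hpar : ∀ x, par x = x ∨ (G.Adj (par x) x ∧ G.dist r (par x) < G.dist r x)) :
    ∃ u v S f, IsEmb G H (par u) u v v S f ∧ φ.weight wV wE = embWeight G wV wE S f := by
  classical
  obtain ⟨x₀⟩ := φ.isTree.1.nonempty
  obtain ⟨u, hu, hmin⟩ := Finset.exists_min_image φ.dom.toFinset (G.dist r)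
    ⟨x₀, by simp⟩
  simp only [Set.mem_toFinset] at hu hmin
  set f : V → W := fun x => if h : x ∈ φ.dom then φ.iso ⟨x, h⟩ else φ.iso ⟨u, hu⟩ with hf
  have hfx : ∀ x : φ.dom, f x = φ.iso x := fun x => by simp [hf]
  have hconn : ∀ x ∈ φ.dom, x ≠ u → ∃ y ∈ φ.dom, G.Adj x y ∧ G.dist u y < G.dist u x := by
    intro x hx hxu
    obtain ⟨q, hq, _⟩ := φ.isTree.1.exists_path_of_dist ⟨x, hx⟩ ⟨u, hu⟩
    cases q with
    | nil => exact absurd rfl hxu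
    | @cons _ y _ hxy q =>
      refine ⟨y, y.2, hxy, ?_⟩
      let F : G.induce φ.dom →g G := (SimpleGraph.Embedding.induce φ.dom).toHom
      have h1 : ((q.cons hxy).map F).IsPath := hq.map (f := F) Subtype.val_injective
      obtain ⟨q', hq', hlen⟩ := hG.connected.exists_path_of_dist x u
      have h2 : (q.cons hxy).map F = q' := (hG.existsUnique_path _ _).unique h1 hq'
      have h3 : q.length + 1 = G.dist x u := by
        have := congrArg SimpleGraph.Walk.length h2
        simp only [SimpleGraph.Walk.length_map, SimpleGraph.Walk.length_cons] at this
        exact this.trans hlen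
      have h4 : G.dist y u ≤ (q.map F).length := SimpleGraph.dist_le (q.map F)
      rw [SimpleGraph.Walk.length_map] at h4
      rw [G.dist_comm (u := u), G.dist_comm (u := u)]
      omega
  have hsub : ∀ x ∈ φ.dom, x ∈ branch G (par u) u := by
    rcases hpar u with h | ⟨hadj, hlt⟩
    · rw [h]
      exact fun x _ => mem_branch_self _ _
    · have hp : par u ∉ φ.dom := fun hp => by
        have := hmin _ hp
        omega
      intro x
      induction hn : G.dist u x using Nat.strong_induction_on generalizing x with
      | _ n ih =>
        intro hx
        by_cases hxu : x = u
        · subst hxu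
          exact root_mem_branch _ _
        · obtain ⟨y, hy, hxy, hlt⟩ := hconn x hx hxu
          have h1 := ih _ (hn ▸ hlt) y rfl hy
          by_contra hc
          exact hp ((branch_crossing hG hadj h1 hc hxy.symm).2 ▸ hx)
  refine ⟨u, f u, φ.dom.toFinset, f, ⟨by simpa using hu, rfl, fun x hx => hsub x (by simpa using hx),
    fun x _ => mem_branch_self _ _, ?_, ?_, fun x hx hxu => ?_⟩,
    φ.weight_eq_embWeight wV wE _ (by simp) f hfx⟩
  · intro x hx y hy hxy
    rw [Set.mem_toFinset] at hx hy
    rw [hfx ⟨x, hx⟩, hfx ⟨y, hy⟩] at hxy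
    exact congrArg Subtype.val (φ.iso.injective (Subtype.ext hxy))
  · intro x hx y hy hxy
    rw [Set.mem_toFinset] at hx hy
    rw [hfx ⟨x, hx⟩, hfx ⟨y, hy⟩]
    exact φ.iso.map_adj_iff.2 (show (G.induce φ.dom).Adj ⟨x, hx⟩ ⟨y, hy⟩ from hxy)
  · simpa using hconn x (by simpa using hx) hxu

end

/-! ### Postorder traversal -/

/-- `p` is the parent of `x` in the tree `G` with root `r`; the parent of the root is the root. -/
def IsParent {V : Type} (G : SimpleGraph V) (r x p : V) : Prop :=
  (x = r ∧ p = r) ∨ (G.Adj p x ∧ G.dist r p < G.dist r x)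

/-- A list of vertices with their parents in which every vertex is followed by its children. -/
def IsRevPostorder {V : Type} (G : SimpleGraph V) (r : V) : List (V × V) → Prop
  | [] => True
  | e :: l => IsRevPostorder G r l ∧ IsParent G r e.1 e.2 ∧ e.1 ∉ l.map Prod.fst ∧
      ∀ x, G.Adj e.1 x → x ≠ e.2 → (x, e.1) ∈ l

section

variable {V : Type} {G : SimpleGraph V}

theorem IsParent.eq_or_adj {r x p : V} (h : IsParent G r x p) : p = x ∨ G.Adj p x := by
  rcases h with ⟨rfl, rfl⟩ | h
  · exact Or.inl rfl
  · exact Or.inr h.1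

theorem IsParent.child (hG : G.IsTree) {r u p c : V} (h : IsParent G r u p) (hc : G.Adj u c)
    (hcp : c ≠ p) : IsParent G r c u := by
  refine Or.inr ⟨hc, ?_⟩
  rcases h with ⟨rfl, rfl⟩ | ⟨h1, h2⟩
  · simpa using hG.connected.pos_dist_of_ne hcp.symm
  · have h3 := hG.dist_eq_dist_add_one_of_adj r hc
    by_contra hlt
    refine hcp (closer_unique (x := r) hG hc h1.symm ?_ ?_) <;>
      simp only [G.dist_comm (v := r)] <;> omega

theorem IsRevPostorder.isParent {r : V} {l : List (V × V)} (h : IsRevPostorder G r l) :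
    ∀ e ∈ l, IsParent G r e.1 e.2 := by
  induction l with
  | nil => simp
  | cons e l ih =>
    intro e' he'
    rcases List.mem_cons.1 he' with rfl | he'
    · exact h.2.1
    · exact ih h.1 e' he'

theorem IsRevPostorder.nodup {r : V} {l : List (V × V)} (h : IsRevPostorder G r l) :
    (l.map Prod.fst).Nodup := by
  induction l with
  | nil => simp
  | cons e l ih => exact List.nodup_cons.2 ⟨h.2.2.1, ih h.1⟩

end

section

variable {n : ℕ} {G : SimpleGraph (Fin n)} {adj : Fin n → List (Fin n)}

theorem mem_children (hadj : IsAdjList G adj) {p u x : Fin n} :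
    x ∈ (removeVertex p (adj u)).val ↔ G.Adj u x ∧ x ≠ p := by
  rw [removeVertex_val, List.mem_filter, (hadj u).2]
  simp

theorem nodup_children (hadj : IsAdjList G adj) (p u : Fin n) :
    (removeVertex p (adj u)).val.Nodup := by
  rw [removeVertex_val]
  exact (hadj u).1.filter _

open Classical in
-- The size of the branch is enough fuel, since the branch at a child omits `u`. Branches at
-- different children are disjoint, so no vertex is listed twice.
theorem postorderAux_spec (hG : G.IsTree) (hadj : IsAdjList G adj) (r : Fin n) (fuel : ℕ)
    (p u : Fin n) (acc : List (Fin n × Fin n)) (hp : IsParent G r u p)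
    (hfuel : (Finset.univ.filter (· ∈ branch G p u)).card ≤ fuel)
    (hacc : IsRevPostorder G r acc) (hdisj : ∀ e ∈ acc, e.1 ∉ branch G p u) :
    IsRevPostorder G r (postorderAux adj fuel p u acc).val ∧
    (u, p) ∈ (postorderAux adj fuel p u acc).val ∧
    (∀ e ∈ acc, e ∈ (postorderAux adj fuel p u acc).val) ∧
    ∀ x, x ∈ (postorderAux adj fuel p u acc).val.map Prod.fst ↔
      x ∈ acc.map Prod.fst ∨ x ∈ branch G p u := by
  induction fuel generalizing p u acc with
  | zero =>
    have : u ∈ Finset.univ.filter (· ∈ branch G p u) := by simp [root_mem_branch]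
    rw [Nat.le_zero, Finset.card_eq_zero] at hfuel
    simp [hfuel] at this
  | succ fuel ih =>
    have hloop : ∀ (cs : List (Fin n)) (acc : List (Fin n × Fin n)),
        (∀ c ∈ cs, G.Adj u c ∧ c ≠ p) → cs.Nodup → IsRevPostorder G r acc →
        (∀ e ∈ acc, ∀ c ∈ cs, e.1 ∉ branch G u c) →
        let res := (forEach cs acc fun acc c => postorderAux adj fuel u c acc).val
        IsRevPostorder G r res ∧ (∀ c ∈ cs, (c, u) ∈ res) ∧ (∀ e ∈ acc, e ∈ res) ∧
        ∀ x, x ∈ res.map Prod.fst ↔ x ∈ acc.map Prod.fst ∨ ∃ c ∈ cs, x ∈ branch G u c := by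
      intro cs
      induction cs with
      | nil => intro acc _ _ h _; simpa using h
      | cons c cs ihc =>
        intro acc hcs hnd hacc hdisj
        obtain ⟨huc, hcp⟩ := hcs c (by simp)
        have hcard : (Finset.univ.filter (· ∈ branch G u c)).card ≤ fuel := by
          refine Nat.le_of_lt_succ (lt_of_lt_of_le (Finset.card_lt_card ?_) hfuel)
          refine Finset.ssubset_iff_of_subset ?_ |>.2 ⟨u, ?_, ?_⟩
          · intro x hx
            simp only [Finset.mem_filter, Finset.mem_univ, true_and] at hx ⊢
            exact branch_subset hG hp.eq_or_adj huc hcp hx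
          · simp [root_mem_branch]
          · simpa using not_mem_branch hG huc
        obtain ⟨h1, h2, h3, h4⟩ := ih u c acc (hp.child hG huc hcp) hcard hacc
          (fun e he => hdisj e he c (by simp))
        obtain ⟨h5, h6, h7, h8⟩ := ihc _ (fun c hc => hcs c (by simp [hc])) (List.nodup_cons.1 hnd).2
          h1 (by
            intro e he c' hc' hb
            rcases (h4 e.1).1 (List.mem_map_of_mem he) with h | h
            · obtain ⟨e', he', hee⟩ := List.mem_map.1 h
              exact hdisj e' he' c' (by simp [hc']) (hee ▸ hb)
            · have := branch_unique hG huc (hcs c' (by simp [hc'])).1 h hb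
              exact (List.nodup_cons.1 hnd).1 (this ▸ hc'))
        simp only [forEach_cons_val]
        refine ⟨h5, ?_, fun e he => h7 e (h3 e he), fun x => ?_⟩
        · intro c' hc'
          rcases List.mem_cons.1 hc' with rfl | hc'
          · exact h7 _ h2
          · exact h6 c' hc'
        · rw [h8, h4]
          simp only [List.mem_cons, exists_eq_or_imp]
          tauto
    have hsub : ∀ c, G.Adj u c → c ≠ p → branch G u c ⊆ branch G p u := fun c h1 h2 =>
      branch_subset hG hp.eq_or_adj h1 h2
    obtain ⟨h1, h2, h3, h4⟩ := hloop (removeVertex p (adj u)).val acc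
      (fun c hc => (mem_children hadj).1 hc) (nodup_children hadj p u) hacc
      (fun e he c hc hb => by
        obtain ⟨h1, h2⟩ := (mem_children hadj).1 hc
        exact hdisj e he (hsub c h1 h2 hb))
    simp only [postorderAux, bind_val, pure_val]
    refine ⟨⟨h1, hp, ?_, fun x hx hxp => h2 x ((mem_children hadj).2 ⟨hx, hxp⟩)⟩, by simp,
      fun e he => List.mem_cons_of_mem _ (h3 e he), fun x => ?_⟩
    · rw [h4]
      rintro (h | ⟨c, hc, hb⟩)
      · obtain ⟨e', he', hee⟩ := List.mem_map.1 h
        exact hdisj e' he' (hee ▸ root_mem_branch _ _)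
      · exact not_mem_branch hG ((mem_children hadj).1 hc).1 hb
    · rw [List.map_cons, List.mem_cons, h4]
      constructor
      · rintro (rfl | h | ⟨c, hc, hb⟩)
        · exact Or.inr (root_mem_branch _ _)
        · exact Or.inl h
        · obtain ⟨h1, h2⟩ := (mem_children hadj).1 hc
          exact Or.inr (hsub c h1 h2 hb)
      · rintro (h | h)
        · exact Or.inr (Or.inl h)
        · by_cases hxu : x = u
          · exact Or.inl hxu
          · obtain ⟨c, huc, hxc⟩ := exists_branch hG hxu
            refine Or.inr (Or.inr ⟨c, (mem_children hadj).2 ⟨huc, ?_⟩, hxc⟩)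
            rintro rfl
            rcases hp.eq_or_adj with h' | h'
            · exact huc.ne h'.symm
            · have h5 := dist_eq_of_mem_branch hG h' h
              have h6 := dist_eq_of_mem_branch hG huc hxc
              omega

theorem postorder_spec (hG : G.IsTree) (hadj : IsAdjList G adj) (r : Fin n) :
    ∃ l, (postorder adj r).val = l.reverse ∧ IsRevPostorder G r l ∧
      ∀ x, x ∈ l.map Prod.fst := by
  classical
  obtain ⟨h1, _, _, h4⟩ := postorderAux_spec hG hadj r n r r [] (Or.inl ⟨rfl, rfl⟩)
    ((Finset.card_le_univ _).trans (by simp)) trivial (by simp)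
  exact ⟨_, rfl, h1, fun x => (h4 x).2 (Or.inr (mem_branch_self _ _))⟩

/-- Each visited vertex of degree `d` pays `2d + 1` for the scan of its list, at most `d` for the
loop over its children, and `1` for its own insertion. -/
theorem postorderAux_time (fuel : ℕ) (p u : Fin n) (acc : List (Fin n × Fin n)) :
    ∃ new, (postorderAux adj fuel p u acc).val = new ++ acc ∧
      (postorderAux adj fuel p u acc).time ≤
        (new.map fun e => 3 * (adj e.1).length + 2).sum := by
  induction fuel generalizing p u acc with
  | zero => exact ⟨[], rfl, by simp [postorderAux]⟩
  | succ fuel ih =>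
    have hloop : ∀ (cs : List (Fin n)) (acc : List (Fin n × Fin n)),
        ∃ new, (forEach cs acc fun acc c => postorderAux adj fuel u c acc).val = new ++ acc ∧
          (forEach cs acc fun acc c => postorderAux adj fuel u c acc).time ≤
            (new.map fun e => 3 * (adj e.1).length + 2).sum + cs.length := by
      intro cs
      induction cs with
      | nil => exact fun acc => ⟨[], rfl, by simp⟩
      | cons c cs ihc =>
        intro acc
        obtain ⟨n1, h1, h2⟩ := ih u c acc
        obtain ⟨n2, h3, h4⟩ := ihc (postorderAux adj fuel u c acc).val
        refine ⟨n2 ++ n1, ?_, ?_⟩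
        · rw [forEach_cons_val, h3, h1, List.append_assoc]
        · rw [forEach_cons_time, List.map_append, List.sum_append, List.length_cons]
          omega
    obtain ⟨new, h1, h2⟩ := hloop (removeVertex p (adj u)).val acc
    refine ⟨(u, p) :: new, ?_, ?_⟩
    · simp only [postorderAux, bind_val, pure_val, h1, List.cons_append]
    · have h3 := removeVertex_length_le p (adj u)
      simp only [postorderAux, bind_time, pure_time, tick_time, removeVertex_time, List.map_cons,
        List.sum_cons]
      omega

theorem sum_map_fst_le {l : List (Fin n × Fin n)} (h : (l.map Prod.fst).Nodup) (g : Fin n → ℕ) :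
    (l.map fun e => g e.1).sum ≤ ∑ x, g x := by
  have := List.sum_toFinset g h
  rw [List.map_map] at this
  change (l.map (g ∘ Prod.fst)).sum ≤ _
  rw [← this]
  exact Finset.sum_le_sum_of_subset (Finset.subset_univ _)

theorem postorder_time_le (hG : G.IsTree) (hadj : IsAdjList G adj) (r : Fin n) :
    (postorder adj r).time ≤ ∑ x, (3 * (adj x).length + 3) := by
  obtain ⟨new, h1, h2⟩ := postorderAux_time (adj := adj) n r r []
  obtain ⟨l, hl, hpost, _⟩ := postorder_spec hG hadj r
  have hnew : new = l := by
    have : (postorder adj r).val = ((postorderAux adj n r r []).val).reverse := rfl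
    rw [hl, h1, List.append_nil] at this
    exact (List.reverse_injective this).symm
  subst hnew
  have h3 := sum_map_fst_le hpost.nodup fun x => 3 * (adj x).length + 3
  have h4 : ∀ l : List (Fin n × Fin n), (l.map fun e => 3 * (adj e.1).length + 3).sum =
      (l.map fun e => 3 * (adj e.1).length + 2).sum + l.length := by
    intro l
    induction l with
    | nil => rfl
    | cons e l ih => simp only [List.map_cons, List.sum_cons, List.length_cons, ih]; omega
  rw [h4] at h3
  unfold postorder
  simp only [bind_time, tick_time, pure_time, h1, List.append_nil]
  omega

/-- By the handshake lemma the degrees of a tree add up to `2 (n - 1)`. -/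
theorem sum_length_adj (hG : G.IsTree) (hadj : IsAdjList G adj) :
    ∑ x, ((adj x).length + 1) ≤ 3 * n := by
  classical
  have h1 : ∀ x, (adj x).length = G.degree x := fun x => by
    rw [← List.toFinset_card_of_nodup (hadj x).1, SimpleGraph.degree]
    congr 1
    ext y
    simp [(hadj x).2]
  have h2 := hG.card_edgeFinset
  have h3 := G.sum_degrees_eq_twice_card_edges
  rw [Fintype.card_fin] at h2
  simp only [Finset.sum_add_distrib, h1, h3, Finset.sum_const, Finset.card_univ, Fintype.card_fin,
    smul_eq_mul]
  omega

theorem length_adj_lt (hadj : IsAdjList G adj) (x : Fin n) : (adj x).length + 1 ≤ n := by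
  have h : (x :: adj x).Nodup := List.nodup_cons.2
    ⟨fun h => G.irrefl (((hadj x).2 x).1 h), (hadj x).1⟩
  simpa using h.length_le_card

end

/-! ### Correctness of the dynamic program -/

/-- `x` is the maximum weight of an embedding that maps `u` to `v` and stays in the branches of `u`
and `v`. -/
def IsMaxEmbWeight {V W : Type} [Fintype V] (G : SimpleGraph V) (H : SimpleGraph W)
    (wV : V → W → WithBot ℝ) (wE : Sym2 V → Sym2 W → WithBot ℝ) (p u : V) (s v : W)
    (x : WithBot ℝ) : Prop :=
  IsGreatest {y | ∃ S f, IsEmb G H p u s v S f ∧ embWeight G wV wE S f = y} x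

theorem forEach_add_val {ι M : Type} [AddCommMonoid M] (g : ι → M) (body : M → ι → Timed M)
    (hbody : ∀ x e, (body x e).val = x + g e) (xs : List ι) (x : M) :
    (forEach xs x body).val = x + (xs.map g).sum := by
  induction xs generalizing x with
  | nil => simp
  | cons e xs ih => rw [forEach_cons_val, ih, hbody, List.map_cons, List.sum_cons, add_assoc]

/-- The body is only required to return a greatest element of a set, so the lemma applies to its own
conclusion and handles the nested loops of `maxEntry`. -/
theorem forEach_isGreatest {ι α : Type} [LinearOrder α] (A : ι → Set α) (body : α → ι → Timed α)
    (hbody : ∀ x i, IsGreatest (insert x (A i)) (body x i).val) (xs : List ι) (x : α) :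
    IsGreatest (insert x {y | ∃ i ∈ xs, y ∈ A i}) (forEach xs x body).val := by
  induction xs generalizing x with
  | nil => simp
  | cons i xs ih =>
    rw [forEach_cons_val]
    obtain ⟨h1, h2⟩ := ih (body x i).val
    obtain ⟨h3, h4⟩ := hbody x i
    constructor
    · rcases h1 with h1 | ⟨j, hj, h1⟩
      · rw [h1]
        rcases h3 with h3 | h3
        · exact Or.inl h3
        · exact Or.inr ⟨i, by simp, h3⟩
      · exact Or.inr ⟨j, by simp [hj], h1⟩
    · have h5 := h2 (Set.mem_insert _ _)
      rintro y (rfl | ⟨j, hj, hy⟩)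
      · exact (h4 (Set.mem_insert _ _)).trans h5
      · rcases List.mem_cons.1 hj with rfl | hj
        · exact (h4 (Set.mem_insert_of_mem _ hy)).trans h5
        · exact h2 (Set.mem_insert_of_mem _ ⟨j, hj, hy⟩)

section

variable {a b : ℕ} {G : SimpleGraph (Fin a)} {H : SimpleGraph (Fin b)}
  {wV : Fin a → Fin b → WithBot ℝ} {wE : Sym2 (Fin a) → Sym2 (Fin b) → WithBot ℝ}

/-- The edge weights of the matching problem for the children `us` of `u` and `vs` of `v`. -/
def childWeights (wE : Sym2 (Fin a) → Sym2 (Fin b) → WithBot ℝ) (D : Table a b) (u : Fin a)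
    (v : Fin b) (us : List (Fin a)) (vs : List (Fin b)) (i : Fin us.length) (j : Fin vs.length) :
    WithBot ℝ :=
  wE s(u, us.get i) s(v, vs.get j) + D (us.get i) v (vs.get j)

theorem solveSubproblem_val (mwm : MatchingProcedure) (D : Table a b) (u : Fin a)
    (v : Fin b) (us : List (Fin a)) (vs : List (Fin b)) :
    (solveSubproblem mwm wV wE D u v us vs).val = if wV u v = ⊥ then ⊥ else
      wV u v + matchingWeight (childWeights wE D u v us vs)
        (mwm us.length vs.length (childWeights wE D u v us vs)).val := by
  unfold solveSubproblem
  simp only [bind_val]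
  split_ifs with h
  · rfl
  · simp only [bind_val, pure_val, tabulate_val]
    rw [forEach_add_val (fun e : Fin us.length × Fin vs.length =>
      wE s(u, us.get e.1) s(v, vs.get e.2) + D (us.get e.1) v (vs.get e.2)) _ (fun _ _ => rfl),
      zero_add]
    rfl

variable {p u : Fin a} {s v : Fin b} {us : List (Fin a)} {vs : List (Fin b)} {D : Table a b}

/-- Glues optimal embeddings for the matched pairs of children. The empty matching is allowed, so an
embedding always exists, possibly of weight `⊥`. -/
theorem exists_isEmb_of_isMatching (hG : G.IsTree) (hH : H.IsTree) (hp : p = u ∨ G.Adj p u)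
    (hs : s = v ∨ H.Adj s v) (hus : ∀ x, x ∈ us ↔ G.Adj u x ∧ x ≠ p) (husn : us.Nodup)
    (hvs : ∀ x, x ∈ vs ↔ H.Adj v x ∧ x ≠ s) (hvsn : vs.Nodup)
    (hD : ∀ c ∈ us, ∀ d ∈ vs, IsMaxEmbWeight G H wV wE u c v d (D c v d))
    {M : List (Fin us.length × Fin vs.length)} (hM : IsMatching M) :
    ∃ S f, IsEmb G H p u s v S f ∧
      embWeight G wV wE S f = wV u v + matchingWeight (childWeights wE D u v us vs) M := by
  have hinj1 : Function.Injective us.get := List.nodup_iff_injective_get.1 husn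
  have hinj2 : Function.Injective vs.get := List.nodup_iff_injective_get.1 hvsn
  set U : Finset (Fin a) := M.toFinset.image fun e => us.get e.1 with hU
  have hUmem : ∀ c, c ∈ U ↔ ∃ e ∈ M, us.get e.1 = c := by
    intro c
    simp [hU]
  have hfst : ∀ e ∈ M, ∀ e' ∈ M, us.get e.1 = us.get e'.1 → e = e' := fun e he e' he' h =>
    List.inj_on_of_nodup_map hM.1 he he' (hinj1 h)
  have hsnd : ∀ e ∈ M, ∀ e' ∈ M, vs.get e.2 = vs.get e'.2 → e = e' := fun e he e' he' h =>
    List.inj_on_of_nodup_map hM.2 he he' (hinj2 h)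
  have hg : ∀ c, ∃ d, ∀ e ∈ M, us.get e.1 = c → d = vs.get e.2 := by
    intro c
    by_cases h : ∃ e ∈ M, us.get e.1 = c
    · obtain ⟨e, he, rfl⟩ := h
      exact ⟨vs.get e.2, fun e' he' h => by rw [hfst e' he' e he h]⟩
    · exact ⟨v, fun e he h' => absurd ⟨e, he, h'⟩ h⟩
  choose g hg using hg
  have hgU : ∀ c ∈ U, c ∈ us ∧ g c ∈ vs := by
    intro c hc
    obtain ⟨e, he, rfl⟩ := (hUmem c).1 hc
    exact ⟨List.get_mem _ _, by rw [hg _ e he rfl]; exact List.get_mem _ _⟩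
  have hTF : ∀ c, ∃ T F, c ∈ U → IsEmb G H u c v (g c) T F ∧ embWeight G wV wE T F = D c v (g c) := by
    intro c
    by_cases hc : c ∈ U
    · obtain ⟨T, F, h⟩ := (hD c (hgU c hc).1 (g c) (hgU c hc).2).1
      exact ⟨T, F, fun _ => h⟩
    · exact ⟨∅, fun _ => v, fun h => absurd h hc⟩
  choose T F hTF using hTF
  obtain ⟨S, f, hS, hw⟩ := exists_glued_isEmb hG hH wV wE hp hs U g T F
    (fun c hc => (hus c).1 (hgU c hc).1) (fun c hc => (hvs _).1 (hgU c hc).2) (by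
      intro c hc c' hc' h
      obtain ⟨e, he, rfl⟩ := (hUmem c).1 hc
      obtain ⟨e', he', rfl⟩ := (hUmem c').1 hc'
      rw [hg _ e he rfl, hg _ e' he' rfl] at h
      rw [hsnd e he e' he' h]) (fun c hc => (hTF c hc).1)
  refine ⟨S, f, hS, hw.trans ?_⟩
  congr 1
  rw [matchingWeight, ← List.sum_toFinset _ hM.1.of_map, hU, Finset.sum_image]
  · refine Finset.sum_congr rfl fun e he => ?_
    rw [List.mem_toFinset] at he
    rw [(hTF _ ((hUmem _).2 ⟨e, he, rfl⟩)).2, hg _ e he rfl]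
    rfl
  · intro e he e' he' h
    exact hfst e (by simpa using he) e' (by simpa using he') h

/-- The neighbours of `u` in `S` are matched with their images. They are children because the
parents lie outside the branches, and each restricted piece is at most the table entry. -/
theorem IsEmb.exists_isMatching (hG : G.IsTree) (hH : H.IsTree)
    (hus : ∀ x, x ∈ us ↔ G.Adj u x ∧ x ≠ p)
    (hvs : ∀ x, x ∈ vs ↔ H.Adj v x ∧ x ≠ s)
    (hD : ∀ c ∈ us, ∀ d ∈ vs, IsMaxEmbWeight G H wV wE u c v d (D c v d))
    {S : Finset (Fin a)} {f : Fin a → Fin b} (h : IsEmb G H p u s v S f) :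
    ∃ M : List (Fin us.length × Fin vs.length), IsMatching M ∧
      embWeight G wV wE S f ≤ wV u v + matchingWeight (childWeights wE D u v us vs) M := by
  classical
  rw [embWeight_decomp hG wV wE f h.mem h.conn, h.map_root]
  set U := S.filter (G.Adj u) with hU
  have hmem : ∀ c ∈ U, c ∈ S ∧ G.Adj u c := fun c hc => Finset.mem_filter.1 hc
  have hcu : ∀ c ∈ U, c ∈ us := fun c hc =>
    (hus c).2 ⟨(hmem c hc).2, h.child_ne hG (hmem c hc).1 (hmem c hc).2⟩
  have hcv : ∀ c ∈ U, f c ∈ vs := fun c hc => (hvs _).2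
    ⟨h.map_root ▸ h.adj u h.mem c (hmem c hc).1 (hmem c hc).2,
      h.map_child_ne hH (hmem c hc).1 (hmem c hc).2⟩
  have h1 : ∀ c : U, ∃ i, us.get i = c := fun c => List.mem_iff_get.1 (hcu c c.2)
  have h2 : ∀ c : U, ∃ j, vs.get j = f c := fun c => List.mem_iff_get.1 (hcv c c.2)
  choose ι hι using h1
  choose κ hκ using h2
  refine ⟨U.attach.toList.map fun c => (ι c, κ c), ⟨?_, ?_⟩, ?_⟩
  · rw [List.map_map]
    refine (Finset.nodup_toList _).map fun c c' hcc => ?_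
    exact Subtype.ext (by rw [← hι c, ← hι c', show ι c = ι c' from hcc])
  · rw [List.map_map]
    refine (Finset.nodup_toList _).map fun c c' hcc => ?_
    refine Subtype.ext (h.inj _ (hmem c c.2).1 _ (hmem c' c'.2).1 ?_)
    rw [← hκ c, ← hκ c', show κ c = κ c' from hcc]
  · gcongr
    rw [matchingWeight, List.map_map, Finset.sum_map_toList, ← Finset.sum_attach]
    refine Finset.sum_le_sum fun c _ => ?_
    simp only [Function.comp_apply, childWeights, hι, hκ]
    gcongr
    exact (hD c (hcu c c.2) (f c) (hcv c c.2)).2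
      ⟨_, _, h.restrict hG hH (hmem c c.2).1 (hmem c c.2).2, rfl⟩

theorem solveSubproblem_spec (hG : G.IsTree) (hH : H.IsTree) {mwm : MatchingProcedure}
    (hmwm : ∀ k l w, IsMWM w (mwm k l w).val) (hp : p = u ∨ G.Adj p u)
    (hs : s = v ∨ H.Adj s v) (hus : ∀ x, x ∈ us ↔ G.Adj u x ∧ x ≠ p) (husn : us.Nodup)
    (hvs : ∀ x, x ∈ vs ↔ H.Adj v x ∧ x ≠ s) (hvsn : vs.Nodup)
    (hD : ∀ c ∈ us, ∀ d ∈ vs, IsMaxEmbWeight G H wV wE u c v d (D c v d)) :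
    IsMaxEmbWeight G H wV wE p u s v (solveSubproblem mwm wV wE D u v us vs).val := by
  obtain ⟨h1, h2⟩ := hmwm us.length vs.length (childWeights wE D u v us vs)
  have hval : (solveSubproblem mwm wV wE D u v us vs).val =
      wV u v + matchingWeight (childWeights wE D u v us vs)
        (mwm us.length vs.length (childWeights wE D u v us vs)).val := by
    rw [solveSubproblem_val]
    -- The early exit of the program agrees with the general formula because `⊥` absorbs addition.
    split_ifs with h
    · rw [h, WithBot.bot_add]
    · rfl
  rw [hval]
  refine ⟨exists_isEmb_of_isMatching hG hH hp hs hus husn hvs hvsn hD h1, ?_⟩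
  rintro _ ⟨S, f, h, rfl⟩
  obtain ⟨M, hM, hle⟩ := h.exists_isMatching hG hH hus hvs hD
  refine hle.trans ?_
  gcongr
  exact h2 M hM

end

section

variable {a b : ℕ} {G : SimpleGraph (Fin a)} {H : SimpleGraph (Fin b)}
  {adjG : Fin a → List (Fin a)} {adjH : Fin b → List (Fin b)}
  {wV : Fin a → Fin b → WithBot ℝ} {wE : Sym2 (Fin a) → Sym2 (Fin b) → WithBot ℝ}
  {mwm : MatchingProcedure}

/-- The computation of one table entry. -/
def entryStep (mwm : MatchingProcedure) (adjH : Fin b → List (Fin b))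
    (wV : Fin a → Fin b → WithBot ℝ) (wE : Sym2 (Fin a) → Sym2 (Fin b) → WithBot ℝ) (u : Fin a)
    (us : List (Fin a)) (v : Fin b) (D : Table a b) (s : Fin b) : Timed (Table a b) := do
  let vs ← removeVertex s (adjH v)
  let x ← solveSubproblem mwm wV wE D u v us vs
  tick 1
  pure (Table.set D u s v x)

/-- The computation of all table entries for a vertex of the first tree. -/
def vertexStep (mwm : MatchingProcedure) (adjG : Fin a → List (Fin a))
    (adjH : Fin b → List (Fin b)) (wV : Fin a → Fin b → WithBot ℝ)
    (wE : Sym2 (Fin a) → Sym2 (Fin b) → WithBot ℝ) (D : Table a b) (up : Fin a × Fin a) :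
    Timed (Table a b) := do
  let us ← removeVertex up.2 (adjG up.1)
  forEach (List.finRange b) D fun D v =>
    forEach (v :: adjH v) D (entryStep mwm adjH wV wE up.1 us v)

/-- The computation of the maximum entry of the table. -/
def maxEntry (adjH : Fin b → List (Fin b)) (D : Table a b) : Timed (WithBot ℝ) :=
  forEach (List.finRange a) ⊥ fun best u =>
    forEach (List.finRange b) best fun best v =>
      forEach (v :: adjH v) best fun best s => do
        tick 2
        pure (max best (D u s v))

theorem maxCommonSubtree_eq (r : Fin a) :
    maxCommonSubtree mwm adjG adjH wV wE r = (do
      tick (a * b * b)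
      let order ← postorder adjG r
      let D ← forEach order (fun _ _ _ => ⊥ : Table a b) (vertexStep mwm adjG adjH wV wE)
      maxEntry adjH D) := rfl

theorem maxEntry_isGreatest (D : Table a b) :
    IsGreatest (insert ⊥ {y | ∃ u v, ∃ s ∈ v :: adjH v, y = D u s v}) (maxEntry adjH D).val := by
  have h := forEach_isGreatest (fun u => {y | ∃ v ∈ List.finRange b, ∃ s ∈ v :: adjH v, y = D u s v})
    (fun best u => forEach (List.finRange b) best fun best v =>
      forEach (v :: adjH v) best fun best s => do
        tick 2
        pure (max best (D u s v)))
    (fun x u => forEach_isGreatest (fun v => {y | ∃ s ∈ v :: adjH v, y = D u s v})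
      (fun best v => forEach (v :: adjH v) best fun best s => do
        tick 2
        pure (max best (D u s v)))
      (fun x v => forEach_isGreatest (fun s => {y | y = D u s v})
        (fun best s => do
          tick 2
          pure (max best (D u s v)))
        (fun x s => by
          simp only [bind_val, pure_val]
          refine ⟨?_, ?_⟩
          · rcases max_choice x (D u s v) with h | h <;> rw [h]
            · exact Or.inl rfl
            · exact Or.inr rfl
          · rintro y (rfl | h)
            · exact le_max_left _ _
            · exact (le_of_eq h).trans (le_max_right _ _)) _ x) _ x)
    (List.finRange a) ⊥
  simp only [List.mem_finRange, true_and] at h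
  exact h

/-- All entries for the vertex `u` with parent `p` are correct. -/
def CorrectAt (G : SimpleGraph (Fin a)) (H : SimpleGraph (Fin b)) (wV : Fin a → Fin b → WithBot ℝ)
    (wE : Sym2 (Fin a) → Sym2 (Fin b) → WithBot ℝ) (D : Table a b) (p u : Fin a) : Prop :=
  ∀ v s, s = v ∨ H.Adj s v → IsMaxEmbWeight G H wV wE p u s v (D u s v)

theorem Table.set_of_ne (D : Table a b) {u u' : Fin a} (h : u' ≠ u) (s v : Fin b)
    (x : WithBot ℝ) : Table.set D u s v x u' = D u' := by
  funext s' v'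
  simp [Table.set, h]

theorem mem_cons_adj (hadjH : IsAdjList H adjH) {s v : Fin b} :
    s ∈ v :: adjH v ↔ s = v ∨ H.Adj s v := by
  rw [List.mem_cons, (hadjH v).2, H.adj_comm]

theorem vertexStep_spec (hG : G.IsTree) (hH : H.IsTree) (hadjG : IsAdjList G adjG)
    (hadjH : IsAdjList H adjH) (hmwm : ∀ k l w, IsMWM w (mwm k l w).val) (D₀ : Table a b)
    {u p : Fin a} (hp : p = u ∨ G.Adj p u)
    (hD₀ : ∀ c, G.Adj u c → c ≠ p → CorrectAt G H wV wE D₀ u c) :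
    (∀ u', u' ≠ u → (vertexStep mwm adjG adjH wV wE D₀ (u, p)).val u' = D₀ u') ∧
      CorrectAt G H wV wE (vertexStep mwm adjG adjH wV wE D₀ (u, p)).val p u := by
  set us := (removeVertex p (adjG u)).val with hus
  -- Loop invariant: only the row of `u` has changed, and the entries in `Q` are correct.
  -- Subproblems read rows of children, never the row of `u`, so overwriting is harmless.
  let P : (Fin b → Fin b → Prop) → Table a b → Prop := fun Q D =>
    (∀ u', u' ≠ u → D u' = D₀ u') ∧ ∀ v s, Q v s → IsMaxEmbWeight G H wV wE p u s v (D u s v)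
  have hcell : ∀ (Q : Fin b → Fin b → Prop) (D : Table a b) (v s : Fin b), s = v ∨ H.Adj s v →
      P Q D → P (fun v' s' => Q v' s' ∨ (v' = v ∧ s' = s))
        (entryStep mwm adjH wV wE u us v D s).val := by
    intro Q D v s hs hP
    have hval : (entryStep mwm adjH wV wE u us v D s).val = Table.set D u s v
        (solveSubproblem mwm wV wE D u v us (removeVertex s (adjH v)).val).val := rfl
    rw [hval]
    have hsol := solveSubproblem_spec (G := G) (H := H) (wV := wV) (wE := wE) (D := D)
      (us := us) (vs := (removeVertex s (adjH v)).val) hG hH hmwm hp hs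
      (fun x => mem_children hadjG) (nodup_children hadjG p u)
      (fun x => mem_children hadjH) (nodup_children hadjH s v) (by
        intro c hc d hd
        obtain ⟨h1, h2⟩ := (mem_children hadjG).1 hc
        obtain ⟨h3, h4⟩ := (mem_children hadjH).1 hd
        rw [hP.1 c h1.ne']
        exact hD₀ c h1 h2 d v (Or.inr h3))
    refine ⟨fun u' hu' => (Table.set_of_ne D hu' s v _).trans (hP.1 u' hu'), fun v' s' hQ => ?_⟩
    by_cases h : v' = v ∧ s' = s
    · obtain ⟨rfl, rfl⟩ := h
      simpa [Table.set] using hsol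
    · have h1 := hP.2 v' s' (hQ.resolve_right h)
      have h2 : ¬ (s' = s ∧ v' = v) := fun h' => h h'.symm
      simpa [Table.set, h2] using h1
  have hrow : ∀ (v : Fin b) (ss : List (Fin b)) (Q : Fin b → Fin b → Prop) (D : Table a b),
      (∀ s ∈ ss, s = v ∨ H.Adj s v) → P Q D →
      P (fun v' s' => Q v' s' ∨ (v' = v ∧ s' ∈ ss))
        (forEach ss D (entryStep mwm adjH wV wE u us v)).val := by
    intro v ss
    induction ss with
    | nil => intro Q D _ h; simpa using h
    | cons s ss ih =>
      intro Q D hss h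
      have h1 := ih _ _ (fun s hs => hss s (by simp [hs])) (hcell Q D v s (hss s (by simp)) h)
      refine ⟨h1.1, fun v' s' hQ => h1.2 v' s' ?_⟩
      simp only [List.mem_cons] at hQ ⊢
      tauto
  have hall : ∀ (vs : List (Fin b)) (Q : Fin b → Fin b → Prop) (D : Table a b), P Q D →
      P (fun v' s' => Q v' s' ∨ (v' ∈ vs ∧ s' ∈ v' :: adjH v'))
        (forEach vs D fun D v => forEach (v :: adjH v) D (entryStep mwm adjH wV wE u us v)).val := by
    intro vs
    induction vs with
    | nil => intro Q D h; simpa using h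
    | cons v vs ih =>
      intro Q D h
      have h1 := ih _ _ (hrow v (v :: adjH v) Q D (fun s hs => (mem_cons_adj hadjH).1 hs) h)
      refine ⟨h1.1, fun v' s' hQ => h1.2 v' s' ?_⟩
      rcases hQ with h | ⟨h, h'⟩
      · exact Or.inl (Or.inl h)
      · rcases List.mem_cons.1 h with rfl | h
        · exact Or.inl (Or.inr ⟨rfl, h'⟩)
        · exact Or.inr ⟨h, h'⟩
  have h := hall (List.finRange b) (fun _ _ => False) D₀ ⟨fun _ _ => rfl, fun _ _ h => h.elim⟩
  exact ⟨h.1, fun v s hs => h.2 v s (Or.inr ⟨List.mem_finRange v, (mem_cons_adj hadjH).2 hs⟩)⟩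

/-- The list is processed from its end, so its head comes last, when the entries of its children are
already correct; later steps write to other rows. -/
theorem forEach_vertexStep_spec (hG : G.IsTree) (hH : H.IsTree) (hadjG : IsAdjList G adjG)
    (hadjH : IsAdjList H adjH) (hmwm : ∀ k l w, IsMWM w (mwm k l w).val) {r : Fin a}
    (D₀ : Table a b) (l : List (Fin a × Fin a)) (hl : IsRevPostorder G r l) :
    ∀ e ∈ l, CorrectAt G H wV wE
      (forEach l.reverse D₀ (vertexStep mwm adjG adjH wV wE)).val e.2 e.1 := by
  induction l with
  | nil => simp
  | cons e l ih =>
    obtain ⟨u, p⟩ := e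
    obtain ⟨hl, hpar, hnot, hch⟩ := hl
    have ih := ih hl
    rw [List.reverse_cons, forEach_append_val]
    simp only [forEach_cons_val, forEach_nil, pure_val]
    obtain ⟨h1, h2⟩ := vertexStep_spec (wV := wV) (wE := wE) hG hH hadjG hadjH hmwm
      (forEach l.reverse D₀ (vertexStep mwm adjG adjH wV wE)).val hpar.eq_or_adj
      (fun c hc hcp => ih _ (hch c hc hcp))
    intro e he
    rcases List.mem_cons.1 he with rfl | he'
    · exact h2
    · intro v s hs
      have hne : e.1 ≠ u := by
        intro h
        exact hnot (List.mem_map.2 ⟨e, he', h⟩)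
      rw [h1 e.1 hne]
      exact ih e he' v s hs

theorem maxCommonSubtree_spec (hG : G.IsTree) (hH : H.IsTree) (hadjG : IsAdjList G adjG)
    (hadjH : IsAdjList H adjH) (hmwm : ∀ k l w, IsMWM w (mwm k l w).val) (r : Fin a) :
    IsMCSTWeight G H wV wE (maxCommonSubtree mwm adjG adjH wV wE r).val := by
  obtain ⟨l, hl, hpost, hmem⟩ := postorder_spec hG hadjG r
  have hval : (maxCommonSubtree mwm adjG adjH wV wE r).val =
      (maxEntry adjH (forEach l.reverse (fun _ _ _ => ⊥ : Table a b)
        (vertexStep mwm adjG adjH wV wE)).val).val := by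
    rw [maxCommonSubtree_eq, ← hl]
    rfl
  have hD := forEach_vertexStep_spec (wV := wV) (wE := wE) hG hH hadjG hadjH hmwm
    (fun _ _ _ => ⊥) l hpost
  rw [hval]
  generalize (forEach l.reverse (fun _ _ _ => ⊥ : Table a b)
        (vertexStep mwm adjG adjH wV wE)).val = D at hD ⊢
  have hpar : ∀ x, ∃ p, (x, p) ∈ l := fun x => by
    obtain ⟨⟨y, p⟩, h, rfl⟩ := List.mem_map.1 (hmem x)
    exact ⟨p, h⟩
  choose par hpar using hpar
  have hcor : ∀ u, CorrectAt G H wV wE D (par u) u := fun u => hD _ (hpar u)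
  obtain ⟨h1, h2⟩ := maxEntry_isGreatest (adjH := adjH) D
  have hle : ∀ u v s, s = v ∨ H.Adj s v → D u s v ≤ (maxEntry adjH D).val := fun u v s hs =>
    h2 (Or.inr ⟨u, v, s, (mem_cons_adj hadjH).2 hs, rfl⟩)
  constructor
  · have hex : ∃ u v s, (s = v ∨ H.Adj s v) ∧ (maxEntry adjH D).val = D u s v := by
      rcases h1 with h1 | ⟨u, v, s, hs, h1⟩
      · obtain ⟨v⟩ := hH.connected.nonempty
        refine ⟨r, v, v, Or.inl rfl, ?_⟩
        have := hle r v v (Or.inl rfl)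
        rw [h1, le_bot_iff] at this
        rw [h1, this]
      · exact ⟨u, v, s, (mem_cons_adj hadjH).1 hs, h1⟩
    obtain ⟨u, v, s, hs, h⟩ := hex
    obtain ⟨S, f, hS, hw⟩ := (hcor u v s hs).1
    obtain ⟨φ, hφ⟩ := hS.exists_iso hG hH wV wE
    exact ⟨φ, by rw [h, ← hw]; exact hφ⟩
  · rintro _ ⟨φ, rfl⟩
    obtain ⟨u, v, S, f, hS, hw⟩ := φ.exists_isEmb hG wV wE par r (fun x => by
      rcases hpost.isParent _ (hpar x) with ⟨h1, h2⟩ | h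
      · exact Or.inl (h2.trans h1.symm)
      · exact Or.inr h)
    simp only [hw]
    exact ((hcor u v v (Or.inl rfl)).2 ⟨S, f, hS, rfl⟩).trans (hle u v v (Or.inl rfl))

end

/-! ### Running time -/

section

variable {a b : ℕ} {G : SimpleGraph (Fin a)} {H : SimpleGraph (Fin b)}
  {adjG : Fin a → List (Fin a)} {adjH : Fin b → List (Fin b)}
  {wV : Fin a → Fin b → WithBot ℝ} {wE : Sym2 (Fin a) → Sym2 (Fin b) → WithBot ℝ}
  {mwm : MatchingProcedure}

/-- The logarithm is bounded by its argument. This crude estimate still suffices for the quartic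
bound and lets the rest of the analysis take place in `ℕ`. -/
theorem ComputesMWM.time_le_nat {c : ℝ} (h : ComputesMWM mwm c) (k l : ℕ)
    (w : Fin k → Fin l → WithBot ℝ) : (mwm k l w).time ≤ ⌈c⌉₊ * (k * l * (2 * (k + l)) + 1) := by
  have h1 : min (k : ℝ) l + Real.log (max (k : ℝ) l) ≤ 2 * (k + l) := by
    have h2 : max (k : ℝ) l ≤ k + l := max_le_add_of_nonneg (by positivity) (by positivity)
    have h3 := Real.log_le_self (x := max (k : ℝ) l) (by positivity)
    have h4 := min_le_max (a := (k : ℝ)) (b := l)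
    linarith
  have h0 : 0 ≤ (k : ℝ) * l * (min (k : ℝ) l + Real.log (max (k : ℝ) l)) := by
    have : 0 ≤ Real.log (max (k : ℝ) l) := by
      rw [← Nat.cast_max]
      exact Real.log_natCast_nonneg _
    positivity
  have h5 : ((mwm k l w).time : ℝ) ≤ ⌈c⌉₊ * (k * l * (2 * (k + l)) + 1) := by
    refine (h.time_le k l w).trans ?_
    gcongr
    exact Nat.le_ceil c
  exact_mod_cast h5

theorem solveSubproblem_time_le {κ : ℕ}
    (hlen : ∀ k l w, (mwm k l w).val.length ≤ k)
    (htime : ∀ k l w, (mwm k l w).time ≤ κ * (k * l * (2 * (k + l)) + 1))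
    (D : Table a b) (u : Fin a) (v : Fin b) (us : List (Fin a)) (vs : List (Fin b)) {A B : ℕ}
    (hus : us.length + 1 ≤ A) (hvs : vs.length + 1 ≤ B) (hA : A ≤ a) (hB : B ≤ b) :
    (solveSubproblem mwm wV wE D u v us vs).time ≤ (13 + 3 * κ) * (A * B * (a + b)) := by
  -- The shift by one makes `A * B` positive even for leaves, so that it absorbs constants: `1 + 2 +
  -- 5 + 3 + 2 = 13` for the test, the two copied lists, the weights, the sum over the matching and
  -- the final addition.
  have hAB : 1 ≤ A * B := Nat.mul_pos (by omega) (by omega)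
  have hN : 1 ≤ a + b := by omega
  have e0 : A * B ≤ A * B * (a + b) := Nat.le_mul_of_pos_right _ hN
  have e1 : us.length * vs.length ≤ A * B := Nat.mul_le_mul (by omega) (by omega)
  have e2 : us.length ≤ A * B := (show us.length ≤ A by omega).trans (Nat.le_mul_of_pos_right _ (by omega))
  have e3 : vs.length ≤ A * B := (show vs.length ≤ B by omega).trans (Nat.le_mul_of_pos_left _ (by omega))
  have e4 : us.length * vs.length * (2 * (us.length + vs.length)) ≤ A * B * (2 * (a + b)) := Nat.mul_le_mul e1 (by omega)
  have e5 : ∀ w, (mwm us.length vs.length w).time ≤ κ * (3 * (A * B * (a + b))) := fun w => by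
    refine (htime us.length vs.length w).trans (Nat.mul_le_mul_left _ ?_)
    have : A * B * (2 * (a + b)) = 2 * (A * B * (a + b)) := by ring
    omega
  have e6 : (13 + 3 * κ) * (A * B * (a + b)) =
    13 * (A * B * (a + b)) + κ * (3 * (A * B * (a + b))) := by ring
  rw [e6]
  unfold solveSubproblem
  simp only [bind_time, tick_time]
  split_ifs with h
  · simp only [pure_time]
    omega
  · simp only [bind_time, tick_time, pure_time]
    generalize hw : (tabulate fun i : Fin us.length => tabulate fun j : Fin vs.length => (do
      tick 3
      pure (wE s(u, us.get i) s(v, vs.get j) + D (us.get i) v (vs.get j)) :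
        Timed (WithBot ℝ))) = w
    have h1 : w.time ≤ us.length * (vs.length * 4 + 1) := by
      rw [← hw]
      exact tabulate_time_le _ _ fun i => tabulate_time_le _ _ fun j => by simp
    have h2 := e5 w.val
    have h3 := hlen us.length vs.length w.val
    have h4 := forEach_time_le_const (mwm us.length vs.length w.val).val (0 : WithBot ℝ) (fun x e => (do
      tick 2
      pure (x + w.val e.1 e.2) : Timed (WithBot ℝ))) 2 (by simp)
    have h5 : us.length * (vs.length * 4 + 1) = 4 * (us.length * vs.length) + us.length := by ring
    have h6 : wV u v ≠ ⊥ := h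
    omega

theorem entryStep_time_le {κ : ℕ} (hadjG : IsAdjList G adjG) (hadjH : IsAdjList H adjH)
    (hlen : ∀ k l w, (mwm k l w).val.length ≤ k)
    (htime : ∀ k l w, (mwm k l w).time ≤ κ * (k * l * (2 * (k + l)) + 1))
    (D : Table a b) (p u : Fin a) (v s : Fin b) :
    (entryStep mwm adjH wV wE u (removeVertex p (adjG u)).val v D s).time ≤
      (15 + 3 * κ) * (((adjG u).length + 1) * ((adjH v).length + 1) * (a + b)) := by
  have h1 := removeVertex_length_le p (adjG u)
  have h2 := removeVertex_length_le s (adjH v)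
  have h3 := solveSubproblem_time_le (wV := wV) (wE := wE) hlen htime D u v
    (removeVertex p (adjG u)).val (removeVertex s (adjH v)).val
    (Nat.add_le_add_right h1 1) (Nat.add_le_add_right h2 1) (length_adj_lt hadjG u)
    (length_adj_lt hadjH v)
  have h4 : (adjH v).length + 1 ≤ ((adjG u).length + 1) * ((adjH v).length + 1) * (a + b) :=
    (Nat.le_mul_of_pos_left _ (by omega)).trans (Nat.le_mul_of_pos_right _ (by have := u.pos; omega))
  unfold entryStep
  simp only [bind_time, tick_time, pure_time, removeVertex_time]
  have h5 : (15 + 3 * κ) * (((adjG u).length + 1) * ((adjH v).length + 1) * (a + b)) =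
    (13 + 3 * κ) * (((adjG u).length + 1) * ((adjH v).length + 1) * (a + b)) +
      2 * (((adjG u).length + 1) * ((adjH v).length + 1) * (a + b)) := by ring
  omega

theorem sum_finRange_map {n : ℕ} (g : Fin n → ℕ) : ((List.finRange n).map g).sum = ∑ x, g x := by
  rw [← List.sum_toFinset _ (List.nodup_finRange n), List.toFinset_finRange]

/-- There are `B` roots `s` for each `v`. One factor `B` is bounded by `b`, as the sum of the
squares may be quadratic; the other is summed to at most `3b`. The `+ 1` is the charge of the
surrounding loop. -/
theorem vertexStep_time_le {κ : ℕ} (hH : H.IsTree) (hadjG : IsAdjList G adjG)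
    (hadjH : IsAdjList H adjH)
    (hlen : ∀ k l w, (mwm k l w).val.length ≤ k)
    (htime : ∀ k l w, (mwm k l w).time ≤ κ * (k * l * (2 * (k + l)) + 1))
    (D : Table a b) (e : Fin a × Fin a) :
    (vertexStep mwm adjG adjH wV wE D e).time + 1 ≤
      (54 + 9 * κ) * (((adjG e.1).length + 1) * (a + b) ^ 3) := by
  obtain ⟨u, p⟩ := e
  set A := (adjG u).length + 1 with hA
  have hN : 1 ≤ a + b := by have := u.pos; omega
  have hrow : ∀ (v : Fin b) (D : Table a b),
      (forEach (v :: adjH v) D (entryStep mwm adjH wV wE u (removeVertex p (adjG u)).val v)).time + 1 ≤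
        (17 + 3 * κ) * (A * (a + b) ^ 2) * ((adjH v).length + 1) := by
    intro v D
    have h1 := forEach_time_le_const (v :: adjH v) D
      (entryStep mwm adjH wV wE u (removeVertex p (adjG u)).val v) _
      (fun s _ D => entryStep_time_le (wV := wV) (wE := wE) hadjG hadjH hlen htime D p u v s)
    set B := (adjH v).length + 1 with hB
    have hBb : B ≤ b := length_adj_lt hadjH v
    have h2 : A * B * (a + b) ≤ A * (a + b) ^ 2 := by
      rw [pow_two, ← mul_assoc]
      gcongr
      omega
    have h3 : 1 ≤ A * (a + b) ^ 2 := Nat.one_le_iff_ne_zero.2 (by positivity)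
    calc (forEach (v :: adjH v) D
          (entryStep mwm adjH wV wE u (removeVertex p (adjG u)).val v)).time + 1
        ≤ B * ((15 + 3 * κ) * (A * (a + b) ^ 2) + A * (a + b) ^ 2) + B * (A * (a + b) ^ 2) := by
          refine Nat.add_le_add (h1.trans ?_) ?_
          · rw [List.length_cons]
            gcongr
          · exact Nat.one_le_iff_ne_zero.2 (by positivity)
      _ = (17 + 3 * κ) * (A * (a + b) ^ 2) * B := by ring
  have h1 := forEach_time_le (List.finRange b) D
    (fun D v => forEach (v :: adjH v) D
      (entryStep mwm adjH wV wE u (removeVertex p (adjG u)).val v))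
    -- One is subtracted because `forEach_time_le` adds it back for the loop iteration.
    (fun v => (17 + 3 * κ) * (A * (a + b) ^ 2) * ((adjH v).length + 1) - 1)
    (fun v _ D => Nat.le_sub_of_add_le (hrow v D))
  have h2 : ∀ v, (17 + 3 * κ) * (A * (a + b) ^ 2) * ((adjH v).length + 1) - 1 + 1 =
      (17 + 3 * κ) * (A * (a + b) ^ 2) * ((adjH v).length + 1) := fun v =>
    Nat.sub_add_cancel (Nat.one_le_iff_ne_zero.2 (by positivity))
  simp only [h2] at h1
  rw [sum_finRange_map, ← Finset.mul_sum] at h1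
  have h3 : (17 + 3 * κ) * (A * (a + b) ^ 2) * ∑ v, ((adjH v).length + 1) ≤
      (17 + 3 * κ) * (A * (a + b) ^ 2) * (3 * (a + b)) :=
    Nat.mul_le_mul_left _ ((sum_length_adj hH hadjH).trans (by omega))
  have h4 : A ≤ A * (a + b) ^ 3 := Nat.le_mul_of_pos_right _ (by positivity)
  unfold vertexStep
  simp only [bind_time, removeVertex_time]
  have h5 : (54 + 9 * κ) * (A * (a + b) ^ 3) =
    (17 + 3 * κ) * (A * (a + b) ^ 2) * (3 * (a + b)) + 3 * (A * (a + b) ^ 3) := by ring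
  omega

theorem maxEntry_time_le (hH : H.IsTree) (hadjH : IsAdjList H adjH) (D : Table a b) :
    (maxEntry adjH D).time ≤ a * (13 * b + 1) := by
  have hrow : ∀ (u : Fin a) (v : Fin b) (x : WithBot ℝ), (forEach (v :: adjH v) x fun best s => (do
      tick 2
      pure (max best (D u s v)) : Timed (WithBot ℝ))).time ≤ 3 * ((adjH v).length + 1) := by
    intro u v x
    refine (forEach_time_le_const _ _ _ 2 (by simp)).trans ?_
    rw [List.length_cons, mul_comm]
  have hall : ∀ (u : Fin a) (x : WithBot ℝ), (forEach (List.finRange b) x fun best v =>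
      forEach (v :: adjH v) best fun best s => (do
        tick 2
        pure (max best (D u s v)) : Timed (WithBot ℝ))).time ≤ 13 * b := by
    intro u x
    refine (forEach_time_le _ _ _ _ (fun v _ x => hrow u v x)).trans ?_
    have h := sum_length_adj hH hadjH
    rw [sum_finRange_map, Finset.sum_add_distrib, ← Finset.mul_sum]
    simp only [Finset.sum_const, Finset.card_univ, Fintype.card_fin, smul_eq_mul]
    omega
  refine (forEach_time_le_const _ _ _ _ (fun u _ x => hall u x)).trans ?_
  rw [List.length_finRange]

/-- Summing the vertex costs over `G` gives another factor `3n`, hence `3 * (54 + 9 * κ)`. The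
remaining `24` is `1` for allocation, `9` for the postorder and `14` for the maximum entry. -/
theorem maxCommonSubtree_time_le {κ : ℕ} (hG : G.IsTree) (hH : H.IsTree)
    (hadjG : IsAdjList G adjG) (hadjH : IsAdjList H adjH)
    (hlen : ∀ k l w, (mwm k l w).val.length ≤ k)
    (htime : ∀ k l w, (mwm k l w).time ≤ κ * (k * l * (2 * (k + l)) + 1)) (r : Fin a) :
    (maxCommonSubtree mwm adjG adjH wV wE r).time ≤ (186 + 27 * κ) * (a + b) ^ 4 := by
  obtain ⟨l, hl, hpost, _⟩ := postorder_spec hG hadjG r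
  have hN : 1 ≤ a + b := by have := r.pos; omega
  have h1 := postorder_time_le hG hadjG r
  have h2 := sum_length_adj hG hadjG
  have h3 := forEach_time_le l.reverse (fun _ _ _ => ⊥ : Table a b)
    (vertexStep mwm adjG adjH wV wE)
    (fun e => (54 + 9 * κ) * (((adjG e.1).length + 1) * (a + b) ^ 3) - 1)
    (fun e _ D => Nat.le_sub_of_add_le (vertexStep_time_le hH hadjG hadjH hlen htime D e))
  have h4 : ∀ u, (54 + 9 * κ) * (((adjG u).length + 1) * (a + b) ^ 3) - 1 + 1 =
      (54 + 9 * κ) * (((adjG u).length + 1) * (a + b) ^ 3) := fun u =>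
    Nat.sub_add_cancel (Nat.one_le_iff_ne_zero.2 (by positivity))
  simp only [h4] at h3
  rw [List.map_reverse, List.sum_reverse] at h3
  have h5 := h3.trans (sum_map_fst_le hpost.nodup
    fun u => (54 + 9 * κ) * (((adjG u).length + 1) * (a + b) ^ 3))
  rw [← Finset.mul_sum, ← Finset.sum_mul] at h5
  have h6 : (54 + 9 * κ) * ((∑ u, ((adjG u).length + 1)) * (a + b) ^ 3) ≤
      (54 + 9 * κ) * (3 * (a + b) * (a + b) ^ 3) := by
    gcongr
    omega
  have h7 : ∑ u, (3 * (adjG u).length + 3) = 3 * ∑ u, ((adjG u).length + 1) := by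
    rw [Finset.mul_sum]
    exact Finset.sum_congr rfl fun u _ => by ring
  have h8 := fun D => maxEntry_time_le (a := a) hH hadjH D
  have e0 : a + b ≤ (a + b) ^ 4 := Nat.le_self_pow (by norm_num) _
  have e1 : a * b * b ≤ (a + b) ^ 4 := by
    calc a * b * b ≤ (a + b) * (a + b) * (a + b) * (a + b) := by
          refine (Nat.mul_le_mul (Nat.mul_le_mul ?_ ?_) ?_).trans (Nat.le_mul_of_pos_right _ hN) <;>
            omega
      _ = (a + b) ^ 4 := by ring
  have e2 : a * b ≤ (a + b) ^ 4 := by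
    calc a * b ≤ (a + b) * (a + b) := Nat.mul_le_mul (by omega) (by omega)
      _ = (a + b) ^ 2 := by ring
      _ ≤ (a + b) ^ 4 := Nat.pow_le_pow_right hN (by norm_num)
  have e3 : (186 + 27 * κ) * (a + b) ^ 4 =
      (54 + 9 * κ) * (3 * (a + b) * (a + b) ^ 3) + 24 * (a + b) ^ 4 := by ring
  have e4 : a * (13 * b + 1) = 13 * (a * b) + a := by ring
  rw [maxCommonSubtree_eq]
  simp only [bind_time, tick_time, hl]
  have h9 := h8 (forEach l.reverse (fun _ _ _ => ⊥ : Table a b)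
    (vertexStep mwm adjG adjH wV wE)).val
  omega

end

theorem ComputesMWM.solvesMCST {mwm : MatchingProcedure} {c : ℝ} (h : ComputesMWM mwm c) :
    SolvesMCSTInQuarticTime mwm (186 + 27 * ⌈c⌉₊ : ℕ) := by
  intro a b G H hG hH adjG adjH hadjG hadjH wV wE r
  refine ⟨maxCommonSubtree_spec hG hH hadjG hadjH h.isMWM r, ?_⟩
  exact_mod_cast maxCommonSubtree_time_le hG hH hadjG hadjH
    (fun k l w => Hungarian.length_le_of_isMatching (h.isMWM k l w).1) h.time_le_nat r

end TreeMCS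
end

/-- The algorithm solves the maximum common subtree isomorphism problem for two unrooted trees in
time `O(n ^ 4)`, where `n` is the sum of their orders: with any procedure for maximum weight
matchings as a black box that takes time `O(k l (min {k, l} + log max {k, l}))`, with a constant
that depends only on the constant of this procedure; and unconditionally, because the Hungarian
method is such a procedure. -/
theorem mainTheorem7 :
    (∀ c : ℝ, ∃ C : ℝ, ∀ mwm : TreeMCS.MatchingProcedure,
      TreeMCS.ComputesMWM mwm c → TreeMCS.SolvesMCSTInQuarticTime mwm C) ∧
    (∃ c : ℝ, TreeMCS.ComputesMWM TreeMCS.Hungarian.mwm c) ∧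
    (∃ C : ℝ, TreeMCS.SolvesMCSTInQuarticTime TreeMCS.Hungarian.mwm C) :=
  ⟨fun c => ⟨(186 + 27 * ⌈c⌉₊ : ℕ), fun _ h => h.solvesMCST⟩,
    ⟨53, TreeMCS.Hungarian.computesMWM_mwm⟩,
    ⟨_, TreeMCS.Hungarian.computesMWM_mwm.solvesMCST⟩⟩
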